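/- Let $\mathbb{B}=\{q\in\mathbb{H}:|q|<1\}$ be the open unit ball of the quaternions, and let $\mathrm{Sp}(1,1)=\{A\in M_2(\mathbb{H}) : A^*I_{1,1}A=I_{1,1}\}$, $I_{1,1}=\operatorname{diag}(1,-1)$, which is a Lie group and an embedded submanifold of $M_2(\mathbb{H})$ of dimension $10$. For functions $f(q)=\sum_n q^na_n$, $g(q)=\sum_n q^nb_n$ given by power series on $\mathbb{B}$, put $(f*g)(q)=\sum_n q^n\sum_{k=0}^n a_kb_{n-k}$, $f^c(q)=\sum_n q^n\overline{a_n}$, $f^s=f*f^c$ and $f^{-*}=(f^s)^{-1}f^c$. For $A=\begin{pmatrix}a&c\\ b&d\end{pmatrix}\in\mathrm{Sp}(1,1)$ the (slice) regular Möbius transformation $\mathcal{F}_A:\mathbb{B}\to\mathbb{B}$ is $$\mathcal{F}_A(q)=(qc+d)^{-*}*(qa+b),$$ which is a well-defined bijection of $\mathbb{B}$. Let $\mathcal{M}(\mathbb{B})=\{\mathcal{F}_A:A\in\mathrm{Sp}(1,1)\}$ carry the quotient topology and the unique ($7$-dimensional) smooth manifold structure for which $\mathrm{Sp}(1,1)\to\mathcal{M}(\mathbb{B})$,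 $A\mapsto\mathcal{F}_{A^{-1}}$, is a submersion. (Equivalently, the structure carried over from the homogeneous space $\mathrm{Sp}(1,1)/\mathrm{Sp}(1)I_2$ by the bijection $A\,\mathrm{Sp}(1)I_2\mapsto\mathcal{F}_{A^{-1}}$; here $\mathrm{Sp}(1)$ is the group of unit quaternions.) A submersion is a surjective smooth map whose differential is surjective at every point. Let $\mathcal{M}(\mathbb{B})_0=\{\mathcal{F}\in\mathcal{M}(\mathbb{B}):\mathcal{F}(0)=0\}$. It is a group under composition of maps, an embedded $3$-dimensional submanifold of $\mathcal{M}(\mathbb{B})$ and a Lie group with this structure, and $(\mathcal{F}_0,\mathcal{F})\mapsto\mathcal{F}_0\circ\mathcal{F}$ is a smooth, free and proper left action of $\mathcal{M}(\mathbb{B})_0$ on $\mathcal{M}(\mathbb{B})$ (proper: for every compact $K\subset\mathcal{M}(\mathbb{B})$ the set $\{g\in\mathcal{M}(\mathbb{B})_0 : gK\cap K\neq\emptyset\}$ is compact). The orbit space $\mathcal{M}(\mathbb{B})_0\backslash\mathcal{M}(\mathbb{B})$, with the quotient topology, has a unique ($4$-dimensional) smooth manifold structure for which the projection $\mathcal{F}\mapsto\mathcal{M}(\mathbb{B})_0\mathcal{F}$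 is a submersion. **Theorem.** The inverse orbit map $\mathcal{M}(\mathbb{B})\to\mathbb{B}$, $\mathcal{F}\mapsto\mathcal{F}^{-1}(0)$, is smooth, and it induces a well-defined map $$\mathcal{M}(\mathbb{B})_0\backslash\mathcal{M}(\mathbb{B})\to\mathbb{B},\qquad \mathcal{M}(\mathbb{B})_0\mathcal{F}\mapsto\mathcal{F}^{-1}(0),$$ which is a diffeomorphism. (The formal statement also contains the existence of the manifold structures named above, and that the action is smooth, free and proper.) -/

import Mathlib

open scoped Quaternion Manifold ContDiff Matrix Topology

noncomputable section

namespace SliceMobius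

/-! ### The unit ball and the regular `*`-calculus -/

/-- The open unit ball of the quaternions. As an open subset of the real normed space `ℍ[ℝ]`
it is a smooth manifold modelled on `ℍ[ℝ]`. -/
def UnitBall : TopologicalSpace.Opens ℍ[ℝ] :=
  ⟨Metric.ball (0 : ℍ[ℝ]) 1, Metric.isOpen_ball⟩

/-- The origin of the unit ball. -/
def origin : UnitBall := ⟨0, by simp [UnitBall]⟩

/-- `f q = ∑ qⁿ aₙ` on the unit ball: `a` is a sequence of right power series coefficients
of `f`. -/
def HasExpansion (f : UnitBall → ℍ[ℝ]) (a : ℕ → ℍ[ℝ]) : Prop :=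
  ∀ q : UnitBall, HasSum (fun n => (q : ℍ[ℝ]) ^ n * a n) (f q)

open Classical in
/-- The (unique) sequence of right power series coefficients of `f`, if there is one. -/
def coeffs (f : UnitBall → ℍ[ℝ]) : ℕ → ℍ[ℝ] :=
  if h : ∃ a, HasExpansion f a then h.choose else 0

/-- The regular `*`-product: `(f * g)(q) = ∑ qⁿ cₙ` with `cₙ = ∑ aₖ bₙ₋ₖ`. -/
def starMul (f g : UnitBall → ℍ[ℝ]) : UnitBall → ℍ[ℝ] := fun q =>
  ∑' n, (q : ℍ[ℝ]) ^ n * ∑ ij ∈ Finset.HasAntidiagonal.antidiagonal n, coeffs f ij.1 * coeffs g ij.2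

/-- The regular conjugate: `fᶜ(q) = ∑ qⁿ āₙ`. -/
def regConj (f : UnitBall → ℍ[ℝ]) : UnitBall → ℍ[ℝ] := fun q =>
  ∑' n, (q : ℍ[ℝ]) ^ n * star (coeffs f n)

/-- The symmetrization: `fˢ = f * fᶜ`. -/
def symmetrization (f : UnitBall → ℍ[ℝ]) : UnitBall → ℍ[ℝ] := starMul f (regConj f)

/-- The regular reciprocal: `f⁻* = (1 / fˢ) fᶜ`. -/
def starInv (f : UnitBall → ℍ[ℝ]) : UnitBall → ℍ[ℝ] := fun q =>
  (symmetrization f q)⁻¹ * regConj f q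

/-- The affine map `l_{(a,b)}(q) = q a + b`. -/
def lin (a b : ℍ[ℝ]) : UnitBall → ℍ[ℝ] := fun q => (q : ℍ[ℝ]) * a + b

/-! ### The group `Sp(1,1)` -/

/-- The matrix `I_{1,1} = diag(1, -1)`. -/
def I11 : Matrix (Fin 2) (Fin 2) ℍ[ℝ] := !![1, 0; 0, -1]

theorem I11_mul_I11 : I11 * I11 = 1 := by
  ext i j : 1
  fin_cases i <;> fin_cases j <;> simp [I11]

theorem I11_star : I11ᴴ = I11 := by
  ext i j : 1
  fin_cases i <;> fin_cases j <;> simp [I11]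

/-- `Sp(1,1) = {A ∈ M₂(ℍ) : A* I_{1,1} A = I_{1,1}}`, a submonoid of `M₂(ℍ)` (a group, see below),
with the subspace topology. -/
def Sp11 : Submonoid (Matrix (Fin 2) (Fin 2) ℍ[ℝ]) where
  carrier := {A | Aᴴ * I11 * A = I11}
  one_mem' := by simp
  mul_mem' := by
    intro A B hA hB
    simp only [Set.mem_ofPred_eq] at hA hB ⊢
    calc (A * B)ᴴ * I11 * (A * B) = Bᴴ * (Aᴴ * I11 * A) * B := by
          simp only [Matrix.conjTranspose_mul, Matrix.mul_assoc]
      _ = I11 := by rw [hA, hB]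

theorem Sp11.left_inv {A : Matrix (Fin 2) (Fin 2) ℍ[ℝ]} (hA : A ∈ Sp11) :
    (I11 * Aᴴ * I11) * A = 1 := by
  have h : Aᴴ * I11 * A = I11 := hA
  rw [Matrix.mul_assoc, Matrix.mul_assoc, ← Matrix.mul_assoc Aᴴ, h, I11_mul_I11]

theorem Sp11.right_inv {A : Matrix (Fin 2) (Fin 2) ℍ[ℝ]} (hA : A ∈ Sp11) :
    A * (I11 * Aᴴ * I11) = 1 :=
  mul_eq_one_comm.mp (Sp11.left_inv hA)

theorem Sp11.row_rel {A : Matrix (Fin 2) (Fin 2) ℍ[ℝ]} (hA : A ∈ Sp11) :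
    A * I11 * Aᴴ = I11 := by
  have h := Sp11.right_inv hA
  calc A * I11 * Aᴴ = A * (I11 * Aᴴ * I11) * I11 := by
        simp only [Matrix.mul_assoc, I11_mul_I11, Matrix.mul_one]
    _ = I11 := by rw [h, Matrix.one_mul]

instance : Inv Sp11 where
  inv A := ⟨I11 * (A : Matrix (Fin 2) (Fin 2) ℍ[ℝ])ᴴ * I11, by
    have h := Sp11.row_rel A.2
    change (I11 * (A : Matrix (Fin 2) (Fin 2) ℍ[ℝ])ᴴ * I11)ᴴ * I11 *
      (I11 * (A : Matrix (Fin 2) (Fin 2) ℍ[ℝ])ᴴ * I11) = I11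
    simp only [Matrix.conjTranspose_mul, Matrix.conjTranspose_conjTranspose, I11_star]
    calc I11 * ((A : Matrix (Fin 2) (Fin 2) ℍ[ℝ]) * I11) * I11 *
          (I11 * (A : Matrix (Fin 2) (Fin 2) ℍ[ℝ])ᴴ * I11)
        = I11 * ((A : Matrix (Fin 2) (Fin 2) ℍ[ℝ]) * I11) * (I11 * I11) *
          ((A : Matrix (Fin 2) (Fin 2) ℍ[ℝ])ᴴ * I11) := by simp only [Matrix.mul_assoc]
      _ = I11 * ((A : Matrix (Fin 2) (Fin 2) ℍ[ℝ]) * I11 *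
          (A : Matrix (Fin 2) (Fin 2) ℍ[ℝ])ᴴ) * I11 := by
            rw [I11_mul_I11]; simp only [Matrix.mul_assoc, Matrix.one_mul]
      _ = I11 := by rw [h, I11_mul_I11, Matrix.one_mul]⟩

instance : Group Sp11 :=
  Group.ofLeftAxioms (fun a b c => mul_assoc a b c) (fun a => one_mul a)
    (fun A => Subtype.ext (Sp11.left_inv A.2))

/-! ### Regular Möbius transformations -/

/-- For `A = (a c; b d)`, the function `l_{(c,d)}⁻* * l_{(a,b)}` on the unit ball, i.e.
`(qc + d)⁻* * (qa + b)`. -/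
def mobiusVal (A : Matrix (Fin 2) (Fin 2) ℍ[ℝ]) : UnitBall → ℍ[ℝ] :=
  starMul (starInv (lin (A 0 1) (A 1 1))) (lin (A 0 0) (A 1 0))

theorem HasExpansion.unique {f : UnitBall → ℍ[ℝ]} {a b : ℕ → ℍ[ℝ]}
    (ha : HasExpansion f a) (hb : HasExpansion f b) : a = b := by
  let P : (ℕ → ℍ[ℝ]) → FormalMultilinearSeries ℝ ℝ ℍ[ℝ] :=
    fun c n => ContinuousMultilinearMap.mkPiRing ℝ (Fin n) (c n)
  have key : ∀ c : ℕ → ℍ[ℝ], HasExpansion f c →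
      HasFPowerSeriesAt (fun t : ℝ => ∑' n, (t : ℍ[ℝ]) ^ n * a n) (P c) 0 := by
    intro c hc
    refine hasFPowerSeriesAt_iff.mpr ?_
    filter_upwards [Metric.ball_mem_nhds (0 : ℝ) one_pos] with t ht
    have ht' : ((t : ℝ) : ℍ[ℝ]) ∈ UnitBall := by
      change ((t : ℝ) : ℍ[ℝ]) ∈ Metric.ball (0 : ℍ[ℝ]) 1
      simpa using ht
    have h1 := (ha ⟨_, ht'⟩).tsum_eq
    have h2 := hc ⟨_, ht'⟩
    simp only [zero_add]
    rw [← h1] at h2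
    have e : (fun n => t ^ n • (P c).coeff n) = fun n => ((t : ℝ) : ℍ[ℝ]) ^ n * c n := by
      funext n
      rw [← Quaternion.coe_pow, Quaternion.coe_mul_eq_smul]
      simp [FormalMultilinearSeries.coeff, P]
    rw [e]
    exact h2
  have h := (key a ha).eq_formalMultilinearSeries (key b hb)
  funext n
  have hn := congrFun h n
  have := congrArg (fun m => m (fun _ => (1 : ℝ))) hn
  simpa [P] using this

theorem coeffs_eq {f : UnitBall → ℍ[ℝ]} {a : ℕ → ℍ[ℝ]} (ha : HasExpansion f a) :
    coeffs f = a := by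
  have h : ∃ a, HasExpansion f a := ⟨a, ha⟩
  rw [coeffs, dif_pos h]
  exact h.choose_spec.unique ha

/-- The coefficients of `q a + b`. -/
def linCoeffs (a b : ℍ[ℝ]) : ℕ → ℍ[ℝ]
  | 0 => b
  | 1 => a
  | _ + 2 => 0

theorem lin_hasExpansion (a b : ℍ[ℝ]) : HasExpansion (lin a b) (linCoeffs a b) := by
  intro q
  have h : HasSum (fun n => (q : ℍ[ℝ]) ^ n * linCoeffs a b n)
      (∑ n ∈ Finset.range 2, (q : ℍ[ℝ]) ^ n * linCoeffs a b n) :=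
    hasSum_sum_of_ne_finset_zero (by
      intro n hn
      match n, hn with
      | 0, h => simp at h
      | 1, h => simp at h
      | n + 2, _ => simp [linCoeffs])
  simpa [Finset.sum_range_succ, linCoeffs, lin, add_comm] using h

theorem regConj_lin (c d : ℍ[ℝ]) : regConj (lin c d) = lin (star c) (star d) := by
  funext q
  rw [regConj, coeffs_eq (lin_hasExpansion c d)]
  have : ∀ n, star (linCoeffs c d n) = linCoeffs (star c) (star d) n := by
    intro n
    match n with
    | 0 => rfl
    | 1 => rfl
    | n + 2 => simp [linCoeffs]
  simp only [this]
  exact (lin_hasExpansion (star c) (star d) q).tsum_eq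

theorem starMul_lin {f : UnitBall → ℍ[ℝ]} {e : ℕ → ℍ[ℝ]} (he : HasExpansion f e)
    (a b : ℍ[ℝ]) (q : UnitBall) :
    starMul f (lin a b) q = f q * b + (q : ℍ[ℝ]) * f q * a := by
  rw [starMul, coeffs_eq he, coeffs_eq (lin_hasExpansion a b)]
  apply HasSum.tsum_eq
  have h1 : HasSum (fun n => (q : ℍ[ℝ]) ^ n * e n * b) (f q * b) := (he q).mul_right b
  have h2 : HasSum (fun n => if n = 0 then (0 : ℍ[ℝ]) else
      (q : ℍ[ℝ]) * ((q : ℍ[ℝ]) ^ (n - 1) * e (n - 1)) * a) ((q : ℍ[ℝ]) * f q * a) := by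
    rw [← hasSum_nat_add_iff' 1]
    simpa using ((he q).mul_left (q : ℍ[ℝ])).mul_right a
  convert h1.add h2 using 2 with n
  rw [Finset.Nat.sum_antidiagonal_eq_sum_range_succ (fun i j => e i * linCoeffs a b j)]
  match n with
  | 0 => simp [linCoeffs]
  | n + 1 =>
    rw [Finset.sum_range_succ, Finset.sum_range_succ, Finset.sum_eq_zero]
    · have h3 : n + 1 - n = 1 := by omega
      simp only [h3, Nat.sub_self, linCoeffs, zero_add, mul_add, Nat.add_eq_zero_iff, one_ne_zero,
        and_false, if_false, Nat.add_sub_cancel, pow_succ']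
      simp only [mul_assoc]
      abel
    · intro k hk
      obtain ⟨m, hm⟩ : ∃ m, n + 1 - k = m + 2 :=
        ⟨n - 1 - k, by have := Finset.mem_range.mp hk; omega⟩
      rw [hm]; simp [linCoeffs]

theorem UnitBall.norm_lt (q : UnitBall) : ‖(q : ℍ[ℝ])‖ < 1 := by
  have h : (q : ℍ[ℝ]) ∈ Metric.ball (0 : ℍ[ℝ]) 1 := q.2
  simpa using h

/-- If `|c| < |d|`, the regular reciprocal of `q c + d` is given by a power series and its value
`S` at `q` solves `S d + q S c = 1`. -/
theorem starInv_lin {c d : ℍ[ℝ]} (hcd : ‖c‖ < ‖d‖) :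
    (∃ e, HasExpansion (starInv (lin c d)) e) ∧
      ∀ q : UnitBall, starInv (lin c d) q * d + (q : ℍ[ℝ]) * starInv (lin c d) q * c = 1 := by
  have hd : d ≠ 0 := by
    rintro rfl
    simp at hcd
    exact absurd hcd (not_lt.mpr (norm_nonneg c))
  have hd' : 0 < ‖d‖ := norm_pos_iff.mpr hd
  set x : ℍ[ℝ] := -(d⁻¹ * c) with hx
  have hxn : ‖x‖ < 1 := by
    rw [hx, norm_neg, norm_mul, norm_inv, inv_mul_lt_iff₀ hd']
    simpa using hcd
  have hsum : ∀ q : UnitBall, Summable (fun n => (q : ℍ[ℝ]) ^ n * x ^ n) := by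
    intro q
    have hq := UnitBall.norm_lt q
    refine Summable.of_norm_bounded (g := fun n => ‖x‖ ^ n)
      (summable_geometric_of_lt_one (norm_nonneg _) hxn) (fun n => ?_)
    rw [norm_mul, norm_pow, norm_pow]
    calc ‖(q : ℍ[ℝ])‖ ^ n * ‖x‖ ^ n ≤ 1 * ‖x‖ ^ n := by
          gcongr
          exact pow_le_one₀ (norm_nonneg _) hq.le
      _ = ‖x‖ ^ n := one_mul _
  set W : UnitBall → ℍ[ℝ] := fun q => ∑' n, (q : ℍ[ℝ]) ^ n * x ^ n with hW
  have hWs : ∀ q : UnitBall, HasSum (fun n => (q : ℍ[ℝ]) ^ n * x ^ n) (W q) :=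
    fun q => (hsum q).hasSum
  have hWeq : ∀ q : UnitBall, W q = 1 + (q : ℍ[ℝ]) * W q * x := by
    intro q
    have h1 : W q = (q : ℍ[ℝ]) ^ 0 * x ^ 0 + ∑' n, (q : ℍ[ℝ]) ^ (n + 1) * x ^ (n + 1) :=
      (hsum q).tsum_eq_zero_add
    have h2 : HasSum (fun n => (q : ℍ[ℝ]) ^ (n + 1) * x ^ (n + 1)) ((q : ℍ[ℝ]) * W q * x) := by
      have e : (fun n => (q : ℍ[ℝ]) ^ (n + 1) * x ^ (n + 1)) =
          fun n => (q : ℍ[ℝ]) * ((q : ℍ[ℝ]) ^ n * x ^ n) * x := by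
        funext n
        rw [pow_succ', pow_succ]; simp only [mul_assoc]
      rw [e]
      exact ((hWs q).mul_left (q : ℍ[ℝ])).mul_right x
    rw [h2.tsum_eq] at h1
    simpa using h1
  have hS : ∀ q : UnitBall, (W q * d⁻¹) * d + (q : ℍ[ℝ]) * (W q * d⁻¹) * c = 1 := by
    intro q
    have h := hWeq q
    rw [inv_mul_cancel_right₀ hd]
    have h2 : (q : ℍ[ℝ]) * (W q * d⁻¹) * c = -((q : ℍ[ℝ]) * W q * x) := by
      rw [hx]; simp only [mul_neg, neg_neg, mul_assoc]
    rw [h2]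
    nth_rewrite 1 [h]
    abel
  have hval : ∀ q : UnitBall, starInv (lin c d) q = W q * d⁻¹ := by
    intro q
    set S := W q * d⁻¹ with hSdef
    have hs := hS q
    rw [← hSdef] at hs
    have hsym : symmetrization (lin c d) q =
        ((q : ℍ[ℝ]) * c + d) * star d + (q : ℍ[ℝ]) * ((q : ℍ[ℝ]) * c + d) * star c := by
      rw [symmetrization, regConj_lin, starMul_lin (lin_hasExpansion c d)]
      rfl
    have hmul : symmetrization (lin c d) q * S = (q : ℍ[ℝ]) * star c + star d := by
      have hr : c * star d + d * star c = ((2 * (c * star d).re : ℝ) : ℍ[ℝ]) := by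
        rw [← Quaternion.self_add_star']
        simp
      have e1 : symmetrization (lin c d) q = ((Quaternion.normSq d : ℝ) : ℍ[ℝ]) +
          (q : ℍ[ℝ]) * ((2 * (c * star d).re : ℝ) : ℍ[ℝ]) +
          (q : ℍ[ℝ]) * (q : ℍ[ℝ]) * ((Quaternion.normSq c : ℝ) : ℍ[ℝ]) := by
        rw [hsym, ← hr, ← Quaternion.self_mul_star, ← Quaternion.self_mul_star]
        noncomm_ring
      have e2 : (q : ℍ[ℝ]) * star c + star d =
          S * ((Quaternion.normSq d : ℝ) : ℍ[ℝ]) +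
          (q : ℍ[ℝ]) * (S * ((2 * (c * star d).re : ℝ) : ℍ[ℝ])) +
          (q : ℍ[ℝ]) * (q : ℍ[ℝ]) * (S * ((Quaternion.normSq c : ℝ) : ℍ[ℝ])) := by
        rw [← hr, ← Quaternion.self_mul_star, ← Quaternion.self_mul_star]
        calc (q : ℍ[ℝ]) * star c + star d
            = (q : ℍ[ℝ]) * (S * d + (q : ℍ[ℝ]) * S * c) * star c
              + (S * d + (q : ℍ[ℝ]) * S * c) * star d := by rw [hs]; simp
          _ = _ := by noncomm_ring
      rw [e1, e2, ← Quaternion.coe_commutes _ S, ← Quaternion.coe_commutes _ S,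
        ← Quaternion.coe_commutes _ S]
      noncomm_ring
    have hne : symmetrization (lin c d) q ≠ 0 := by
      intro h0
      rw [h0, zero_mul] at hmul
      have h1 : star d = -((q : ℍ[ℝ]) * star c) := by
        rw [eq_neg_iff_add_eq_zero, add_comm]; exact hmul.symm
      have h2 := congrArg norm h1
      rw [norm_neg, norm_mul, norm_star, norm_star] at h2
      have h3 : ‖(q : ℍ[ℝ])‖ * ‖c‖ ≤ 1 * ‖c‖ := by
        gcongr
        exact (UnitBall.norm_lt q).le
      linarith
    rw [starInv, regConj_lin]
    change _ * ((q : ℍ[ℝ]) * star c + star d) = _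
    rw [← hmul, inv_mul_cancel_left₀ hne]
  refine ⟨⟨fun n => x ^ n * d⁻¹, fun q => ?_⟩, fun q => ?_⟩
  · rw [hval]
    have e : (fun n => (q : ℍ[ℝ]) ^ n * (x ^ n * d⁻¹)) =
        fun n => (q : ℍ[ℝ]) ^ n * x ^ n * d⁻¹ := by
      funext n
      rw [mul_assoc]
    rw [e]
    exact (hWs q).mul_right d⁻¹
  · rw [hval]; exact hS q

section
variable {A : Matrix (Fin 2) (Fin 2) ℍ[ℝ]}

open Quaternion in
theorem Sp11.col00 (hA : A ∈ Sp11) : normSq (A 0 0) - normSq (A 1 0) = 1 := by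
  have h : Aᴴ * I11 * A = I11 := hA
  have h0 := congrFun (congrFun h 0) 0
  simp [Matrix.mul_apply, Fin.sum_univ_two, I11, star_mul_self] at h0
  have := congrArg (fun z : ℍ[ℝ] => z.re) h0
  simp at this
  linarith

open Quaternion in
theorem Sp11.col11 (hA : A ∈ Sp11) : normSq (A 1 1) - normSq (A 0 1) = 1 := by
  have h : Aᴴ * I11 * A = I11 := hA
  have h0 := congrFun (congrFun h 1) 1
  simp [Matrix.mul_apply, Fin.sum_univ_two, I11, star_mul_self] at h0
  have := congrArg (fun z : ℍ[ℝ] => z.re) h0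
  simp at this
  linarith

theorem Sp11.col01 (hA : A ∈ Sp11) : star (A 0 0) * A 0 1 = star (A 1 0) * A 1 1 := by
  have h : Aᴴ * I11 * A = I11 := hA
  have h0 := congrFun (congrFun h 0) 1
  simp [Matrix.mul_apply, Fin.sum_univ_two, I11] at h0
  exact add_neg_eq_zero.mp h0

open Quaternion in
theorem Sp11.row00 (hA : A ∈ Sp11) : normSq (A 0 0) - normSq (A 0 1) = 1 := by
  have h := Sp11.row_rel hA
  have h0 := congrFun (congrFun h 0) 0
  simp [Matrix.mul_apply, Fin.sum_univ_two, I11, self_mul_star] at h0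
  have := congrArg (fun z : ℍ[ℝ] => z.re) h0
  simp at this
  linarith

theorem Sp11.row01 (hA : A ∈ Sp11) : A 0 0 * star (A 1 0) = A 0 1 * star (A 1 1) := by
  have h := Sp11.row_rel hA
  have h0 := congrFun (congrFun h 0) 1
  simp [Matrix.mul_apply, Fin.sum_univ_two, I11] at h0
  exact add_neg_eq_zero.mp h0

theorem norm_lt_of_normSq_lt {x y : ℍ[ℝ]} (h : Quaternion.normSq x < Quaternion.normSq y) :
    ‖x‖ < ‖y‖ := by
  rw [Quaternion.normSq_eq_norm_mul_self, Quaternion.normSq_eq_norm_mul_self] at h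
  exact lt_of_mul_self_lt_mul_self₀ (norm_nonneg _) h

theorem normSq_lt_one {x : ℍ[ℝ]} (h : ‖x‖ < 1) : Quaternion.normSq x < 1 := by
  rw [Quaternion.normSq_eq_norm_mul_self]
  nlinarith [norm_nonneg x]

theorem Sp11.norm_c_lt_d (hA : A ∈ Sp11) : ‖A 0 1‖ < ‖A 1 1‖ :=
  norm_lt_of_normSq_lt (by linarith [Sp11.col11 hA])

theorem Sp11.norm_c_lt_a (hA : A ∈ Sp11) : ‖A 0 1‖ < ‖A 0 0‖ :=
  norm_lt_of_normSq_lt (by linarith [Sp11.row00 hA])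

theorem Sp11.exists_S (hA : A ∈ Sp11) (q : UnitBall) :
    ∃ S : ℍ[ℝ], S * A 1 1 + (q : ℍ[ℝ]) * S * A 0 1 = 1 ∧
      mobiusVal A q = S * A 1 0 + (q : ℍ[ℝ]) * S * A 0 0 := by
  obtain ⟨⟨e, he⟩, h⟩ := starInv_lin (Sp11.norm_c_lt_d hA)
  exact ⟨_, h q, starMul_lin he _ _ q⟩

theorem unique_S {c d S T : ℍ[ℝ]} (hcd : ‖c‖ < ‖d‖) (q : UnitBall)
    (hS : S * d + (q : ℍ[ℝ]) * S * c = 1) (hT : T * d + (q : ℍ[ℝ]) * T * c = 1) : S = T := by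
  by_contra hne
  have h0 : 0 < ‖S - T‖ := norm_pos_iff.mpr (sub_ne_zero.mpr hne)
  have h : (S - T) * d = -((q : ℍ[ℝ]) * (S - T) * c) := by
    rw [eq_neg_iff_add_eq_zero]
    calc (S - T) * d + (q : ℍ[ℝ]) * (S - T) * c
        = (S * d + (q : ℍ[ℝ]) * S * c) - (T * d + (q : ℍ[ℝ]) * T * c) := by noncomm_ring
      _ = 0 := by rw [hS, hT, sub_self]
  have h1 := congrArg norm h
  rw [norm_neg, norm_mul, norm_mul, norm_mul] at h1
  have h2 := UnitBall.norm_lt q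
  have h3 : ‖(q : ℍ[ℝ])‖ * ‖S - T‖ * ‖c‖ ≤ 1 * ‖S - T‖ * ‖c‖ := by gcongr
  have h4 : ‖S - T‖ * ‖c‖ < ‖S - T‖ * ‖d‖ := by gcongr
  linarith

theorem Sp11.mobiusVal_eq (hA : A ∈ Sp11) (q : UnitBall) {S : ℍ[ℝ]}
    (hS : S * A 1 1 + (q : ℍ[ℝ]) * S * A 0 1 = 1) :
    mobiusVal A q = S * A 1 0 + (q : ℍ[ℝ]) * S * A 0 0 := by
  obtain ⟨T, hT, h⟩ := Sp11.exists_S hA q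
  rw [unique_S (Sp11.norm_c_lt_d hA) q hS hT, h]

/-- Relation with the classical Möbius transformation, at the conjugate point
`p = S⁻¹ q S`. -/
theorem Sp11.exists_p (hA : A ∈ Sp11) (q : UnitBall) :
    ∃ p S : ℍ[ℝ], ‖p‖ < 1 ∧ S ≠ 0 ∧ p = S⁻¹ * (q : ℍ[ℝ]) * S ∧
      S * (p * A 0 1 + A 1 1) = 1 ∧ mobiusVal A q = S * (p * A 0 0 + A 1 0) := by
  obtain ⟨S, hS, h⟩ := Sp11.exists_S hA q
  have hS0 : S ≠ 0 := by
    rintro rfl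
    simp at hS
  refine ⟨S⁻¹ * (q : ℍ[ℝ]) * S, S, ?_, hS0, rfl, ?_, ?_⟩
  · rw [norm_mul, norm_mul, norm_inv, mul_right_comm,
      inv_mul_cancel₀ (norm_ne_zero_iff.mpr hS0), one_mul]
    exact UnitBall.norm_lt q
  · rw [mul_add, ← mul_assoc, mul_assoc S⁻¹, mul_inv_cancel_left₀ hS0, add_comm]
    exact hS
  · rw [h, mul_add, ← mul_assoc S (S⁻¹ * _ * S), mul_assoc S⁻¹, mul_inv_cancel_left₀ hS0, add_comm]

theorem Sp11.num_lt_den (hA : A ∈ Sp11) {p : ℍ[ℝ]} (hp : ‖p‖ < 1) :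
    ‖p * A 0 0 + A 1 0‖ < ‖p * A 0 1 + A 1 1‖ := by
  apply norm_lt_of_normSq_lt
  have h := normSq_lt_one hp
  rw [Quaternion.normSq_add, Quaternion.normSq_add, mul_assoc, mul_assoc, Sp11.row01 hA,
    map_mul, map_mul]
  have h0 := Sp11.row00 hA
  have h1 := Sp11.col00 hA
  have h2 := Sp11.col11 hA
  nlinarith

theorem Sp11.mobiusVal_mem (hA : A ∈ Sp11) (q : UnitBall) : mobiusVal A q ∈ UnitBall := by
  change mobiusVal A q ∈ Metric.ball (0 : ℍ[ℝ]) 1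
  obtain ⟨p, S, hp, hS0, -, h1, h2⟩ := Sp11.exists_p hA q
  have h3 := congrArg norm h1
  rw [norm_mul, norm_one] at h3
  have h4 := Sp11.num_lt_den hA hp
  have h5 : 0 < ‖S‖ := norm_pos_iff.mpr hS0
  rw [mem_ball_zero_iff, h2, norm_mul, ← h3]
  gcongr

end

/-- The regular Möbius transformation `𝓕_A : 𝔹 → 𝔹` of `A ∈ Sp(1,1)`. -/
def regMobius (A : Sp11) : UnitBall → UnitBall := fun q =>
  ⟨mobiusVal A q, Sp11.mobiusVal_mem A.2 q⟩

theorem regMobius_injective (A : Sp11) : Function.Injective (regMobius A) := by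
  intro q₁ q₂ h
  have hv : mobiusVal A q₁ = mobiusVal A q₂ := congrArg Subtype.val h
  obtain ⟨p₁, S₁, hp₁, hS₁, e₁, f₁, g₁⟩ := Sp11.exists_p A.2 q₁
  obtain ⟨p₂, S₂, hp₂, hS₂, e₂, f₂, g₂⟩ := Sp11.exists_p A.2 q₂
  set a := (A : Matrix (Fin 2) (Fin 2) ℍ[ℝ]) 0 0
  set b := (A : Matrix (Fin 2) (Fin 2) ℍ[ℝ]) 1 0
  set c := (A : Matrix (Fin 2) (Fin 2) ℍ[ℝ]) 0 1 with hc
  set d := (A : Matrix (Fin 2) (Fin 2) ℍ[ℝ]) 1 1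
  set w := mobiusVal A q₁ with hw
  have hw1 : ‖w‖ < 1 := by
    have := UnitBall.norm_lt (regMobius A q₁)
    exact this
  have k₁ : p₁ * (c * w - a) = b - d * w := by
    have : (p₁ * c + d) * w = p₁ * a + b := by
      rw [g₁, ← mul_assoc, mul_eq_one_comm.mp f₁, one_mul]
    rw [mul_sub, ← mul_assoc, sub_eq_sub_iff_add_eq_add, ← add_mul, this, add_comm]
  have k₂ : p₂ * (c * w - a) = b - d * w := by
    have : (p₂ * c + d) * w = p₂ * a + b := by
      rw [hv, g₂, ← mul_assoc, mul_eq_one_comm.mp f₂, one_mul]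
    rw [mul_sub, ← mul_assoc, sub_eq_sub_iff_add_eq_add, ← add_mul, this, add_comm]
  have hne : c * w - a ≠ 0 := by
    intro h0
    have h1 := congrArg norm (sub_eq_zero.mp h0)
    rw [norm_mul] at h1
    have h2 : ‖c‖ * ‖w‖ ≤ ‖c‖ * 1 := by gcongr
    have h3 := Sp11.norm_c_lt_a A.2
    change ‖c‖ < ‖a‖ at h3
    linarith
  have hp : p₁ = p₂ := mul_right_cancel₀ hne (k₁.trans k₂.symm)
  have hS : S₁ = S₂ := by
    rw [← hp] at f₂
    rw [eq_inv_of_mul_eq_one_left f₁, eq_inv_of_mul_eq_one_left f₂]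
  have hq : ∀ {p S q : ℍ[ℝ]}, S ≠ 0 → p = S⁻¹ * q * S → q = S * p * S⁻¹ := by
    intro p S q hS h
    rw [h, mul_assoc S⁻¹, mul_inv_cancel_left₀ hS, mul_inv_cancel_right₀ hS]
  apply Subtype.ext
  rw [hq hS₁ e₁, hq hS₂ e₂, hp, hS]

theorem regMobius_surjective (A : Sp11) : Function.Surjective (regMobius A) := by
  intro w
  have hw := UnitBall.norm_lt w
  have hA := A.2
  set a := (A : Matrix (Fin 2) (Fin 2) ℍ[ℝ]) 0 0 with ha
  set b := (A : Matrix (Fin 2) (Fin 2) ℍ[ℝ]) 1 0 with hb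
  set c := (A : Matrix (Fin 2) (Fin 2) ℍ[ℝ]) 0 1 with hc
  set d := (A : Matrix (Fin 2) (Fin 2) ℍ[ℝ]) 1 1 with hd
  have hlt : ‖b - d * (w : ℍ[ℝ])‖ < ‖c * (w : ℍ[ℝ]) - a‖ := by
    rw [norm_sub_rev (c * _) a, ← norm_star, ← norm_star (a - _)]
    apply norm_lt_of_normSq_lt
    have h := normSq_lt_one hw
    have h0 : Quaternion.normSq a - Quaternion.normSq c = 1 := Sp11.row00 hA
    have h1 : Quaternion.normSq a - Quaternion.normSq b = 1 := Sp11.col00 hA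
    have h2 : Quaternion.normSq d - Quaternion.normSq c = 1 := Sp11.col11 hA
    have h3 : star a * c = star b * d := Sp11.col01 hA
    rw [sub_eq_add_neg, sub_eq_add_neg, star_add, star_add, Quaternion.normSq_add,
      Quaternion.normSq_add, star_star, star_star, mul_neg, mul_neg, ← mul_assoc, ← mul_assoc, h3]
    simp only [Quaternion.normSq_star, Quaternion.normSq_neg, map_mul]
    nlinarith
  have hne : c * (w : ℍ[ℝ]) - a ≠ 0 := norm_pos_iff.mp (lt_of_le_of_lt (norm_nonneg _) hlt)
  obtain ⟨p, hp⟩ : ∃ p, p = (b - d * (w : ℍ[ℝ])) * (c * (w : ℍ[ℝ]) - a)⁻¹ := ⟨_, rfl⟩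
  have hp1 : ‖p‖ < 1 := by
    rw [hp, norm_mul, norm_inv, ← div_eq_mul_inv, div_lt_one (norm_pos_iff.mpr hne)]
    exact hlt
  have hk : p * (c * (w : ℍ[ℝ]) - a) = b - d * (w : ℍ[ℝ]) := by
    rw [hp, inv_mul_cancel_right₀ hne]
  have hk2 : (p * c + d) * (w : ℍ[ℝ]) = p * a + b := by
    rw [mul_sub, ← mul_assoc, sub_eq_sub_iff_add_eq_add] at hk
    rw [add_mul, hk, add_comm]
  have hden : p * c + d ≠ 0 :=
    norm_pos_iff.mp (lt_of_le_of_lt (norm_nonneg _) (Sp11.num_lt_den hA hp1))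
  have hqm : (p * c + d)⁻¹ * p * (p * c + d) ∈ UnitBall := by
    change _ ∈ Metric.ball (0 : ℍ[ℝ]) 1
    rw [mem_ball_zero_iff, norm_mul, norm_mul, norm_inv, mul_right_comm,
      inv_mul_cancel₀ (norm_ne_zero_iff.mpr hden), one_mul]
    exact hp1
  refine ⟨⟨_, hqm⟩, Subtype.ext ?_⟩
  have e : (p * c + d)⁻¹ * p * (p * c + d) * (p * c + d)⁻¹ = (p * c + d)⁻¹ * p :=
    mul_inv_cancel_right₀ hden _
  have h := Sp11.mobiusVal_eq hA ⟨_, hqm⟩ (S := (p * c + d)⁻¹) (by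
    change _ * d + (p * c + d)⁻¹ * p * (p * c + d) * (p * c + d)⁻¹ * c = 1
    rw [e, mul_assoc, ← mul_add, add_comm d, inv_mul_cancel₀ hden])
  change mobiusVal A _ = _
  rw [h]
  change _ * b + (p * c + d)⁻¹ * p * (p * c + d) * (p * c + d)⁻¹ * a = _
  rw [e, mul_assoc, ← mul_add, add_comm b, ← hk2, inv_mul_cancel_left₀ hden]

theorem regMobius_bijective (A : Sp11) : Function.Bijective (regMobius A) :=
  ⟨regMobius_injective A, regMobius_surjective A⟩

/-- The set `𝓜(𝔹) = {𝓕_A : A ∈ Sp(1,1)}` of all regular Möbius transformations of the unit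
ball. -/
def RegularMobius : Type := Set.range regMobius

instance : CoeFun RegularMobius (fun _ => UnitBall → UnitBall) := ⟨fun F => F.1⟩

theorem RegularMobius.ext {F G : RegularMobius} (h : ∀ q, F q = G q) : F = G :=
  Subtype.ext (funext h)

theorem RegularMobius.bijective (F : RegularMobius) : Function.Bijective F := by
  obtain ⟨A, hA⟩ := F.2
  rw [← hA]
  exact regMobius_bijective A

/-- The map `Sp(1,1) → 𝓜(𝔹)`, `A ↦ 𝓕_{A⁻¹}`. -/
def toRegularMobius (A : Sp11) : RegularMobius := ⟨regMobius A⁻¹, A⁻¹, rfl⟩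

/-- The topology of `𝓜(𝔹)`: the quotient topology for `A ↦ 𝓕_{A⁻¹}`. -/
instance : TopologicalSpace RegularMobius :=
  TopologicalSpace.coinduced toRegularMobius inferInstance

/-- The inverse orbit map at the origin, `𝓕 ↦ 𝓕⁻¹(0)`. -/
def inverseOrbit (F : RegularMobius) : UnitBall :=
  (Equiv.ofBijective F F.bijective).symm origin

/-! ### The isotropy group at the origin and its action -/

/-- The isotropy `𝓜(𝔹)₀ = {𝓕 ∈ 𝓜(𝔹) : 𝓕(0) = 0}`. -/
def Isotropy : Type := {F : RegularMobius // F origin = origin}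

/-- The inclusion of the isotropy in `𝓜(𝔹)`. -/
def Isotropy.incl (g : Isotropy) : RegularMobius := g.1

/-- The isotropy has the subspace topology. -/
instance : TopologicalSpace Isotropy := TopologicalSpace.induced Isotropy.incl inferInstance

instance : CoeFun Isotropy (fun _ => UnitBall → UnitBall) := ⟨fun g => g.incl⟩

theorem Isotropy.ext {g h : Isotropy} (H : ∀ q, g q = h q) : g = h :=
  Subtype.ext (RegularMobius.ext H)

theorem Isotropy.map_origin (g : Isotropy) : g origin = origin := g.2

theorem diag_mul_mem (A : Sp11) {u : ℍ[ℝ]} (hu : Quaternion.normSq u = 1) :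
    (A : Matrix (Fin 2) (Fin 2) ℍ[ℝ]) * !![u, 0; 0, 1] ∈ Sp11 := by
  refine Sp11.mul_mem A.2 ?_
  change (!![u, 0; 0, 1] : Matrix (Fin 2) (Fin 2) ℍ[ℝ])ᴴ * I11 * !![u, 0; 0, 1] = I11
  ext i j : 1
  fin_cases i <;> fin_cases j <;>
    simp [Matrix.mul_apply, Fin.sum_univ_two, I11, Quaternion.star_mul_self, hu]

/-- Right multiplication of values by a unit quaternion preserves `𝓜(𝔹)`. -/
theorem exists_rotate (F : RegularMobius) {u : ℍ[ℝ]} (hu : Quaternion.normSq u = 1) :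
    ∃ G : RegularMobius, ∀ q, (G q : ℍ[ℝ]) = (F q : ℍ[ℝ]) * u := by
  obtain ⟨A, hA⟩ := F.2
  refine ⟨⟨_, ⟨⟨_, diag_mul_mem A hu⟩, rfl⟩⟩, fun q => ?_⟩
  obtain ⟨S, hS, h⟩ := Sp11.exists_S A.2 q
  have hF : (F q : ℍ[ℝ]) = mobiusVal A q := by
    rw [← hA]; rfl
  rw [hF, h]
  change mobiusVal _ q = _
  rw [Sp11.mobiusVal_eq (diag_mul_mem A hu) q (S := S)
    (by simpa [Matrix.mul_apply, Fin.sum_univ_two] using hS)]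
  simp [Matrix.mul_apply, Fin.sum_univ_two, add_mul, mul_assoc]

theorem exists_id : ∃ G : RegularMobius, ∀ q, G q = q := by
  refine ⟨⟨_, ⟨1, rfl⟩⟩, fun q => Subtype.ext ?_⟩
  change mobiusVal (1 : Matrix (Fin 2) (Fin 2) ℍ[ℝ]) q = _
  rw [Sp11.mobiusVal_eq (Sp11.one_mem) q (S := 1) (by simp)]
  simp

theorem Isotropy.exists_unit (g : Isotropy) :
    ∃ u : ℍ[ℝ], Quaternion.normSq u = 1 ∧ ∀ q, (g q : ℍ[ℝ]) = (q : ℍ[ℝ]) * u := by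
  obtain ⟨A, hA⟩ := g.1.2
  have hg : ∀ q, (g q : ℍ[ℝ]) = mobiusVal A q := by
    intro q
    change ((g.1.1 q : UnitBall) : ℍ[ℝ]) = _
    rw [← hA]; rfl
  have hmem := A.2
  set a := (A : Matrix (Fin 2) (Fin 2) ℍ[ℝ]) 0 0 with ha
  set b := (A : Matrix (Fin 2) (Fin 2) ℍ[ℝ]) 1 0 with hb
  set c := (A : Matrix (Fin 2) (Fin 2) ℍ[ℝ]) 0 1 with hc
  set d := (A : Matrix (Fin 2) (Fin 2) ℍ[ℝ]) 1 1 with hd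
  have h0 : Quaternion.normSq a - Quaternion.normSq c = 1 := Sp11.row00 hmem
  have h1 : Quaternion.normSq a - Quaternion.normSq b = 1 := Sp11.col00 hmem
  have h2 : Quaternion.normSq d - Quaternion.normSq c = 1 := Sp11.col11 hmem
  have hd0 : d ≠ 0 := by
    intro h
    rw [h, map_zero] at h2
    have := Quaternion.normSq_nonneg (a := c)
    linarith
  have hbz : b = 0 := by
    have h := Sp11.mobiusVal_eq hmem origin (S := d⁻¹)
      (by simp [origin, ← hd, inv_mul_cancel₀ hd0])
    rw [← hg, g.map_origin] at h
    simpa [origin, ← hb, hd0] using h.symm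
  have hcz : c = 0 := by
    rw [← Quaternion.normSq_eq_zero]
    rw [hbz, map_zero] at h1
    linarith
  rw [hbz, map_zero] at h1
  rw [hcz, map_zero] at h2
  refine ⟨d⁻¹ * a, ?_, fun q => ?_⟩
  · rw [map_mul, Quaternion.normSq_inv]
    have h3 : Quaternion.normSq a = 1 := by linarith
    have h4 : Quaternion.normSq d = 1 := by linarith
    rw [h3, h4]; simp
  · rw [hg, Sp11.mobiusVal_eq hmem q (S := d⁻¹)
      (by rw [← hc, ← hd, hcz, mul_zero, add_zero, inv_mul_cancel₀ hd0])]
    rw [← hb, hbz, mul_zero, zero_add, mul_assoc]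

theorem Isotropy.exists_comp (g : Isotropy) (F : RegularMobius) :
    ∃ G : RegularMobius, G.1 = g ∘ F := by
  obtain ⟨u, hu, h⟩ := g.exists_unit
  obtain ⟨G, hG⟩ := exists_rotate F hu
  exact ⟨G, funext fun q => Subtype.ext (by rw [hG]; exact (h _).symm)⟩

/-- The composition `𝓕₀ ∘ 𝓕` of `𝓕₀ ∈ 𝓜(𝔹)₀` and `𝓕 ∈ 𝓜(𝔹)`, as an element of `𝓜(𝔹)`. -/
instance : SMul Isotropy RegularMobius where
  smul g F := ⟨g ∘ F, by
    obtain ⟨G, hG⟩ := g.exists_comp F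
    rw [← hG]; exact G.2⟩

theorem Isotropy.smul_apply (g : Isotropy) (F : RegularMobius) (q : UnitBall) :
    (g • F) q = g (F q) := rfl

/-- The product of the isotropy group is the composition of maps. -/
instance : Mul Isotropy where
  mul g h := ⟨g • h.incl, by
    rw [Isotropy.smul_apply, h.map_origin, g.map_origin]⟩

theorem Isotropy.mul_apply (g h : Isotropy) (q : UnitBall) : (g * h) q = g (h q) := rfl

instance : One Isotropy where
  one := ⟨⟨id, by
    obtain ⟨G, hG⟩ := exists_id
    have : G.1 = id := funext hG
    rw [← this]; exact G.2⟩, rfl⟩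

theorem Isotropy.one_apply (q : UnitBall) : (1 : Isotropy) q = q := rfl

theorem Isotropy.exists_inv (g : Isotropy) : ∃ h : Isotropy, ∀ q, h (g q) = q := by
  obtain ⟨u, hu, h⟩ := g.exists_unit
  obtain ⟨G, hG⟩ := exists_rotate (1 : Isotropy).incl (u := u⁻¹)
    (by rw [Quaternion.normSq_inv, hu, inv_one])
  have hG' : ∀ q, (G q : ℍ[ℝ]) = (q : ℍ[ℝ]) * u⁻¹ := hG
  have hu0 : u ≠ 0 := by
    rintro rfl
    simp at hu
  refine ⟨⟨G, Subtype.ext (by rw [hG']; simp [origin])⟩, fun q => Subtype.ext ?_⟩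
  change ((G (g q) : UnitBall) : ℍ[ℝ]) = _
  rw [hG', h, mul_inv_cancel_right₀ hu0]

/-- The inverse in the isotropy group is the inverse map. -/
instance : Inv Isotropy where
  inv g := g.exists_inv.choose

instance : Group Isotropy :=
  Group.ofLeftAxioms (fun _ _ _ => rfl) (fun _ => rfl)
    (fun g => Isotropy.ext g.exists_inv.choose_spec)

instance : MulAction Isotropy RegularMobius where
  one_smul _ := rfl
  mul_smul _ _ _ := rfl

/-- The quotient `𝓜(𝔹)₀ \ 𝓜(𝔹)`, i.e. the space of orbits `𝓜(𝔹)₀ 𝓕`, with the quotient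
topology. -/
abbrev OrbitSpace : Type := Quotient (MulAction.orbitRel Isotropy RegularMobius)

/-- The projection `𝓕 ↦ 𝓜(𝔹)₀ 𝓕`. -/
def orbitProj (F : RegularMobius) : OrbitSpace := Quotient.mk _ F

/-! ### Submersions and embedded submanifolds -/

/-- The inclusion of `Sp(1,1)` in the real vector space of `2 × 2` quaternionic matrices. -/
def Sp11.incl (A : Sp11) : Fin 2 → Fin 2 → ℍ[ℝ] :=
  fun i j => (A : Matrix (Fin 2) (Fin 2) ℍ[ℝ]) i j

section
variable (E F : Type*) [NormedAddCommGroup E] [NormedSpace ℝ E]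
  [NormedAddCommGroup F] [NormedSpace ℝ F]
  {M N : Type*} [TopologicalSpace M] [ChartedSpace E M] [TopologicalSpace N] [ChartedSpace F N]

/-- A submersion: a surjective smooth map with surjective differential at every point. -/
structure IsSmoothSubmersion (f : M → N) : Prop where
  contMDiff : ContMDiff 𝓘(ℝ, E) 𝓘(ℝ, F) ∞ f
  surjective : Function.Surjective f
  mfderiv_surjective : ∀ x, Function.Surjective (mfderiv 𝓘(ℝ, E) 𝓘(ℝ, F) f x)

/-- A smooth embedding: a smooth map with injective differential at every point, that is a
homeomorphism onto its image. For the inclusion of a subset this says that the subset is an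
embedded submanifold. -/
structure IsEmbeddingOfManifolds (f : M → N) : Prop where
  contMDiff : ContMDiff 𝓘(ℝ, E) 𝓘(ℝ, F) ∞ f
  isEmbedding : Topology.IsEmbedding f
  mfderiv_injective : ∀ x, Function.Injective (mfderiv 𝓘(ℝ, E) 𝓘(ℝ, F) f x)

end

/-- The model space of `n`-dimensional manifolds. -/
abbrev Model (n : ℕ) : Type := EuclideanSpace ℝ (Fin n)

end SliceMobius

end

open SliceMobius

noncomputable section

namespace SliceMobius

/-! ### Universal properties of embedded submanifolds and submersions -/

section
variable {E F : Type*} [NormedAddCommGroup E] [NormedSpace ℝ E]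
  [NormedAddCommGroup F] [NormedSpace ℝ F]
  {M N : Type*} [TopologicalSpace M] [ChartedSpace E M] [TopologicalSpace N] [ChartedSpace F N]
  {G K : Type*} [NormedAddCommGroup G] [NormedSpace ℝ G] [TopologicalSpace K]
  {J : ModelWithCorners ℝ G K}
  {P : Type*} [TopologicalSpace P] [ChartedSpace K P]

/-! Everything becomes explicit in global coordinates. A matrix of Sp(1,1) factors uniquely as
diag(u*, 1) · r (1 p*; p 1) · diag(v, v), with u, v unit quaternions, p in the ball and r = (1 -
|p|²)^(-1/2); this is the homeomorphism `spCoord` onto Sp(1) × Sp(1) × 𝔹. The factor diag(v, v)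
cancels from 𝓕_{A⁻¹}, which takes the value (qT - Tp)u at q, where T - qTp* = 1
(`toRegularMobius_ofCoord_apply`). Hence 𝓜(𝔹) is Sp(1) × 𝔹 (`mobCoord`), and A ↦ 𝓕_{A⁻¹} forgets v.

The zero of this transformation is p, so the inverse orbit map is the projection (u, p) ↦ p. The
isotropy is the slice p = 0, made of the maps q ↦ qu, and it acts by right translation on u, leaving
p fixed (`mobCoord_smul`). The orbits are therefore the fibres of the projection, and the orbit
space is the ball (`orbCoord`). Freeness is cancellation in Sp(1); properness follows from its
compactness.

Existence of the manifold structures is obtained by transport along these homeomorphisms. The other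
assertions concern arbitrary structures with the prescribed embedding or submersion property. Two
universal properties handle them: smoothness into an embedded submanifold is tested after the
inclusion, and smoothness out of a submersion is tested after precomposition. They make each
coordinate map a diffeomorphism for every admissible structure. -/

theorem hasMFDerivAt_extChartAt_self [IsManifold 𝓘(ℝ, E) ∞ M] (x : M) :
    HasMFDerivAt 𝓘(ℝ, E) 𝓘(ℝ, E) (extChartAt 𝓘(ℝ, E) x) x (ContinuousLinearMap.id ℝ E) := by
  have h := (contMDiffAt_extChartAt (I := 𝓘(ℝ, E)) (n := ∞) (x := x)).mdifferentiableAt (by simp)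
  have h1 := h.hasMFDerivAt
  rw [mfderiv_extChartAt_self] at h1
  exact h1

theorem contMDiffAt_extChartAt_symm_self [IsManifold 𝓘(ℝ, E) ∞ M] (x : M) :
    ContMDiffAt 𝓘(ℝ, E) 𝓘(ℝ, E) ∞ (extChartAt 𝓘(ℝ, E) x).symm (extChartAt 𝓘(ℝ, E) x x) :=
  (contMDiffOn_extChartAt_symm x).contMDiffAt (extChartAt_target_mem_nhds x)

theorem hasMFDerivAt_extChartAt_symm_self [IsManifold 𝓘(ℝ, E) ∞ M] (x : M) :
    HasMFDerivAt 𝓘(ℝ, E) 𝓘(ℝ, E) (extChartAt 𝓘(ℝ, E) x).symm (extChartAt 𝓘(ℝ, E) x x)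
      (ContinuousLinearMap.id ℝ E) := by
  have h1 := ((contMDiffAt_extChartAt_symm_self (E := E) x).mdifferentiableAt (by simp)).hasMFDerivAt
  have h2 := mfderivWithin_range_extChartAt_symm (I := 𝓘(ℝ, E)) (x := x)
  simp only [modelWithCornersSelf_coe, Set.range_id, mfderivWithin_univ] at h2
  rw [h2] at h1
  exact h1

/-- The inverse function theorem for a map from a manifold to its model space. -/
theorem exists_local_leftInverse [CompleteSpace E] [IsManifold 𝓘(ℝ, E) ∞ M] {f : M → E} {x : M}
    (hf : ContMDiffAt 𝓘(ℝ, E) 𝓘(ℝ, E) ∞ f x) {e : E ≃L[ℝ] E}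
    (hd : HasMFDerivAt 𝓘(ℝ, E) 𝓘(ℝ, E) f x (e : E →L[ℝ] E)) :
    ∃ g : E → M, ContMDiffAt 𝓘(ℝ, E) 𝓘(ℝ, E) ∞ g (f x) ∧ ∀ᶠ y in 𝓝 x, g (f y) = y := by
  have hs := contMDiffAt_extChartAt_symm_self (E := E) x
  have hsd := hasMFDerivAt_extChartAt_symm_self (E := E) x
  have hx : (extChartAt 𝓘(ℝ, E) x).symm (extChartAt 𝓘(ℝ, E) x x) = x := extChartAt_to_inv x
  set a := extChartAt 𝓘(ℝ, E) x x with ha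
  -- In the chart at `x` the derivative is still `e`, because the inverse chart has identity
  -- derivative at the base point; the inverse function theorem in `E` applies.
  set φ : E → E := f ∘ (extChartAt 𝓘(ℝ, E) x).symm with hφ
  have hφd : ContDiffAt ℝ ∞ φ a := by
    rw [← contMDiffAt_iff_contDiffAt]
    exact ContMDiffAt.comp a (by rw [hx]; exact hf) hs
  have hfd : HasFDerivAt φ (e : E →L[ℝ] E) a := by
    exact (HasMFDerivAt.comp a (g' := (e : E →L[ℝ] E)) (by rw [hx]; exact hd) hsd).hasFDerivAt
  have hL := hφd.to_localInverse hfd (by simp)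
  have hLi := (hφd.hasStrictFDerivAt' hfd (by simp)).eventually_left_inverse
  have hφa : φ a = f x := by rw [hφ, Function.comp_apply, hx]
  refine ⟨(extChartAt 𝓘(ℝ, E) x).symm ∘ hφd.localInverse hfd (by simp), ?_, ?_⟩
  · rw [← hφa]
    refine ContMDiffAt.comp _ ?_ hL.contMDiffAt
    rw [hφd.localInverse_apply_image hfd]
    exact hs
  · have hc : Filter.Tendsto (extChartAt 𝓘(ℝ, E) x) (𝓝 x) (𝓝 a) := continuousAt_extChartAt x
    filter_upwards [hc.eventually hLi, extChartAt_source_mem_nhds (I := 𝓘(ℝ, E)) x] with y hy hy'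
    have h3 : (extChartAt 𝓘(ℝ, E) x).symm (extChartAt 𝓘(ℝ, E) x y) = y :=
      (extChartAt 𝓘(ℝ, E) x).left_inv hy'
    have h4 : φ (extChartAt 𝓘(ℝ, E) x y) = f y := by
      rw [hφ, Function.comp_apply, h3]
    rw [h4] at hy
    exact (congrArg (extChartAt 𝓘(ℝ, E) x).symm hy).trans h3

/-- A continuous map into an immersed manifold is smooth if its composition with the immersion
is. -/
theorem contMDiff_of_comp_immersion [FiniteDimensional ℝ E] [FiniteDimensional ℝ F]
    [IsManifold 𝓘(ℝ, E) ∞ M] [IsManifold 𝓘(ℝ, F) ∞ N] {i : M → N}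
    (hi : ContMDiff 𝓘(ℝ, E) 𝓘(ℝ, F) ∞ i)
    (hinj : ∀ x, Function.Injective (mfderiv 𝓘(ℝ, E) 𝓘(ℝ, F) i x))
    {f : P → M} (hf : Continuous f) (hif : ContMDiff J 𝓘(ℝ, F) ∞ (i ∘ f)) :
    ContMDiff J 𝓘(ℝ, E) ∞ f := by
  have : CompleteSpace E := FiniteDimensional.complete ℝ E
  intro p
  set x := f p with hx
  have hch : ContMDiffAt 𝓘(ℝ, F) 𝓘(ℝ, F) ∞ (extChartAt 𝓘(ℝ, F) (i x)) (i x) :=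
    contMDiffAt_extChartAt
  set D : E →L[ℝ] F := mfderiv 𝓘(ℝ, E) 𝓘(ℝ, F) i x with hD
  have hDi : Function.Injective D := hinj x
  -- Following `i` by a chart and by a linear left inverse of its derivative gives a map with
  -- derivative the identity. Its local inverse `g` recovers `f` from `i ∘ f`.
  obtain ⟨L, hL⟩ := LinearMap.exists_leftInverse_of_injective (D : E →ₗ[ℝ] F)
    (LinearMap.ker_eq_bot.mpr hDi)
  set L' : F →L[ℝ] E := LinearMap.toContinuousLinearMap L
  have hL' : L' ∘L D = ContinuousLinearMap.id ℝ E := by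
    ext v
    exact LinearMap.congr_fun hL v
  have hLs : ContMDiff 𝓘(ℝ, F) 𝓘(ℝ, E) ∞ L' := L'.contMDiff
  have hk : ContMDiffAt 𝓘(ℝ, E) 𝓘(ℝ, E) ∞ (L' ∘ extChartAt 𝓘(ℝ, F) (i x) ∘ i) x :=
    hLs.contMDiffAt.comp x (hch.comp x (hi x))
  have hid : HasMFDerivAt 𝓘(ℝ, E) 𝓘(ℝ, F) i x D :=
    ((hi x).mdifferentiableAt (by simp)).hasMFDerivAt
  have hkd : HasMFDerivAt 𝓘(ℝ, E) 𝓘(ℝ, E) (L' ∘ extChartAt 𝓘(ℝ, F) (i x) ∘ i) x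
      (ContinuousLinearMap.id ℝ E) := by
    rw [← hL']
    exact L'.hasMFDerivAt.comp x ((hasMFDerivAt_extChartAt_self (i x)).comp x hid)
  obtain ⟨g, hg, hgk⟩ := exists_local_leftInverse hk
    (e := ContinuousLinearEquiv.refl ℝ E) hkd
  -- Continuity of `f` keeps its values in the neighbourhood of `x` on which `g` is a left inverse.
  have hev : f =ᶠ[𝓝 p] g ∘ L' ∘ extChartAt 𝓘(ℝ, F) (i x) ∘ (i ∘ f) := by
    filter_upwards [hf.continuousAt.eventually hgk] with y hy using hy.symm
  refine ContMDiffAt.congr_of_eventuallyEq ?_ hev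
  exact ContMDiffAt.comp p hg (hLs.contMDiffAt.comp p (ContMDiffAt.comp p hch (hif p)))

/-- A submersion has local smooth sections. -/
theorem exists_local_section [FiniteDimensional ℝ E] [FiniteDimensional ℝ F]
    [IsManifold 𝓘(ℝ, E) ∞ M] [IsManifold 𝓘(ℝ, F) ∞ N] {f : M → N} {x : M}
    (hf : ContMDiffAt 𝓘(ℝ, E) 𝓘(ℝ, F) ∞ f x)
    (hs : Function.Surjective (mfderiv 𝓘(ℝ, E) 𝓘(ℝ, F) f x)) :
    ∃ s : N → M, ContMDiffAt 𝓘(ℝ, F) 𝓘(ℝ, E) ∞ s (f x) ∧ ∀ᶠ y in 𝓝 (f x), f (s y) = y := by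
  have : CompleteSpace F := FiniteDimensional.complete ℝ F
  have hcs := contMDiffAt_extChartAt_symm_self (E := E) x
  have hcd := hasMFDerivAt_extChartAt_symm_self (E := E) x
  have hx : (extChartAt 𝓘(ℝ, E) x).symm (extChartAt 𝓘(ℝ, E) x x) = x := extChartAt_to_inv x
  have hch : ContMDiffAt 𝓘(ℝ, F) 𝓘(ℝ, F) ∞ (extChartAt 𝓘(ℝ, F) (f x)) (f x) :=
    contMDiffAt_extChartAt
  set a := extChartAt 𝓘(ℝ, E) x x with ha
  set D : E →L[ℝ] F := mfderiv 𝓘(ℝ, E) 𝓘(ℝ, F) f x with hD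
  have hDs : Function.Surjective D := hs
  obtain ⟨R, hR⟩ := LinearMap.exists_rightInverse_of_surjective (D : E →ₗ[ℝ] F)
    (LinearMap.range_eq_top.mpr hDs)
  set R' : F →L[ℝ] E := LinearMap.toContinuousLinearMap R
  have hR' : D ∘L R' = ContinuousLinearMap.id ℝ F := by
    ext v
    exact LinearMap.congr_fun hR v
  -- An affine slice through `x` in the direction of a right inverse of `D`; restricted to it, `f`
  -- has identity derivative in charts and can be inverted locally.
  set ρ : F → E := fun z => a + R' z with hρ
  have hρ0 : ρ 0 = a := by simp [hρ]
  have hρs : ContDiff ℝ ∞ ρ := contDiff_const.add R'.contDiff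
  have hρd : HasFDerivAt ρ R' 0 := R'.hasFDerivAt.const_add a
  set h : F → M := (extChartAt 𝓘(ℝ, E) x).symm ∘ ρ with hh
  have hh0 : h 0 = x := by simp only [hh, Function.comp_apply, hρ0, hx]
  have hhs : ContMDiffAt 𝓘(ℝ, F) 𝓘(ℝ, E) ∞ h 0 :=
    ContMDiffAt.comp (0 : F) (by rw [hρ0]; exact hcs) hρs.contMDiff.contMDiffAt
  have hhd : HasMFDerivAt 𝓘(ℝ, F) 𝓘(ℝ, E) h 0 R' :=
    HasMFDerivAt.comp (0 : F) (g' := ContinuousLinearMap.id ℝ E) (by rw [hρ0]; exact hcd)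
      hρd.hasMFDerivAt
  set φ : F → F := extChartAt 𝓘(ℝ, F) (f x) ∘ f ∘ h with hφ
  have hfh : ContMDiffAt 𝓘(ℝ, F) 𝓘(ℝ, F) ∞ (f ∘ h) 0 :=
    ContMDiffAt.comp (0 : F) (by rw [hh0]; exact hf) hhs
  have hφs : ContDiffAt ℝ ∞ φ 0 := by
    rw [← contMDiffAt_iff_contDiffAt]
    refine ContMDiffAt.comp (0 : F) ?_ hfh
    rw [Function.comp_apply, hh0]
    exact hch
  have hφd : HasFDerivAt φ (ContinuousLinearEquiv.refl ℝ F : F →L[ℝ] F) 0 := by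
    have hfd : HasMFDerivAt 𝓘(ℝ, E) 𝓘(ℝ, F) f (h 0) D := by
      rw [hh0]; exact (hf.mdifferentiableAt (by simp)).hasMFDerivAt
    have hed : HasMFDerivAt 𝓘(ℝ, F) 𝓘(ℝ, F) (extChartAt 𝓘(ℝ, F) (f x)) ((f ∘ h) 0)
        (ContinuousLinearMap.id ℝ F) := by
      rw [Function.comp_apply, hh0]; exact hasMFDerivAt_extChartAt_self (f x)
    have hall : HasFDerivAt φ (D ∘L R') 0 :=
      (HasMFDerivAt.comp (0 : F) hed (HasMFDerivAt.comp (0 : F) hfd hhd)).hasFDerivAt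
    rw [hR'] at hall
    exact hall
  have hψ := hφs.to_localInverse hφd (by simp)
  have hψr := (hφs.hasStrictFDerivAt' hφd (by simp)).eventually_right_inverse
  have hφ0 : φ 0 = extChartAt 𝓘(ℝ, F) (f x) (f x) := by simp [hφ, hh0]
  have hψ0 := hφs.localInverse_apply_image hφd (by simp)
  set ψ := hφs.localInverse hφd (by simp)
  rw [hφ0] at hψ hψ0 hψr
  have hsm : ContMDiffAt 𝓘(ℝ, F) 𝓘(ℝ, F) ∞ (ψ ∘ extChartAt 𝓘(ℝ, F) (f x)) (f x) :=
    hψ.contMDiffAt.comp (f x) hch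
  have hval : (ψ ∘ extChartAt 𝓘(ℝ, F) (f x)) (f x) = 0 := hψ0
  have hs1 : ContMDiffAt 𝓘(ℝ, F) 𝓘(ℝ, E) ∞ (h ∘ ψ ∘ extChartAt 𝓘(ℝ, F) (f x)) (f x) :=
    ContMDiffAt.comp (f x) (by rw [hval]; exact hhs) hsm
  refine ⟨h ∘ ψ ∘ extChartAt 𝓘(ℝ, F) (f x), hs1, ?_⟩
  have hc : Filter.Tendsto (extChartAt 𝓘(ℝ, F) (f x)) (𝓝 (f x))
      (𝓝 (extChartAt 𝓘(ℝ, F) (f x) (f x))) := continuousAt_extChartAt (f x)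
  -- The local inverse only equates chart coordinates of `f (s y)` and `y`. To conclude by
  -- injectivity of the chart, `f (s y)` must stay in its source.
  have hfs : Filter.Tendsto (fun y => f (h (ψ (extChartAt 𝓘(ℝ, F) (f x) y)))) (𝓝 (f x))
      (𝓝 (f x)) := by
    have h5 : ContinuousAt (f ∘ (h ∘ ψ ∘ extChartAt 𝓘(ℝ, F) (f x))) (f x) := by
      refine ContinuousAt.comp ?_ hs1.continuousAt
      rw [Function.comp_apply, hval, hh0]
      exact hf.continuousAt
    have h6 : (f ∘ (h ∘ ψ ∘ extChartAt 𝓘(ℝ, F) (f x))) (f x) = f x := by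
      rw [Function.comp_apply, Function.comp_apply, hval, hh0]
    have h7 := h5.tendsto
    rw [h6] at h7
    exact h7
  filter_upwards [hc.eventually hψr, extChartAt_source_mem_nhds (I := 𝓘(ℝ, F)) (f x),
    hfs.eventually (extChartAt_source_mem_nhds (I := 𝓘(ℝ, F)) (f x))] with y h1 h2 h3
  exact (extChartAt 𝓘(ℝ, F) (f x)).injOn h3 h2 h1

/-- A map on the base of a surjective submersion is smooth if its composition with the
submersion is. -/
theorem IsSmoothSubmersion.contMDiff_of_comp [FiniteDimensional ℝ E] [FiniteDimensional ℝ F]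
    [IsManifold 𝓘(ℝ, E) ∞ M] [IsManifold 𝓘(ℝ, F) ∞ N] {f : M → N}
    (hf : IsSmoothSubmersion E F f) {g : N → P} (hg : ContMDiff 𝓘(ℝ, E) J ∞ (g ∘ f)) :
    ContMDiff 𝓘(ℝ, F) J ∞ g := by
  intro y
  obtain ⟨x, rfl⟩ := hf.surjective y
  obtain ⟨s, hs, hfs⟩ := exists_local_section (hf.contMDiff x) (hf.mfderiv_surjective x)
  have hev : g =ᶠ[𝓝 (f x)] (g ∘ f) ∘ s := by
    filter_upwards [hfs] with z hz
    simp [hz]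
  exact (ContMDiffAt.comp (f x) (hg (s (f x))) hs).congr_of_eventuallyEq hev

theorem IsEmbeddingOfManifolds.contMDiff_of_comp [FiniteDimensional ℝ E] [FiniteDimensional ℝ F]
    [IsManifold 𝓘(ℝ, E) ∞ M] [IsManifold 𝓘(ℝ, F) ∞ N] {i : M → N}
    (hi : IsEmbeddingOfManifolds E F i) {f : P → M} (hif : ContMDiff J 𝓘(ℝ, F) ∞ (i ∘ f)) :
    ContMDiff J 𝓘(ℝ, E) ∞ f :=
  contMDiff_of_comp_immersion hi.contMDiff hi.mfderiv_injective
    (hi.isEmbedding.continuous_iff.mpr hif.continuous) hif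

end

/-! ### Differentials of maps with one-sided inverses; transport of structure -/

section
variable {E E' E'' : Type*} [NormedAddCommGroup E] [NormedSpace ℝ E]
  [NormedAddCommGroup E'] [NormedSpace ℝ E'] [NormedAddCommGroup E''] [NormedSpace ℝ E'']
  {H H' H'' : Type*} [TopologicalSpace H] [TopologicalSpace H'] [TopologicalSpace H'']
  {I : ModelWithCorners ℝ E H} {I' : ModelWithCorners ℝ E' H'} {I'' : ModelWithCorners ℝ E'' H''}
  {M M' M'' : Type*} [TopologicalSpace M] [ChartedSpace H M] [TopologicalSpace M']
  [ChartedSpace H' M'] [TopologicalSpace M''] [ChartedSpace H'' M'']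

theorem mfderiv_injective_of_comp {f : M → M'} {g : M' → M''} {x : M}
    (hg : MDifferentiableAt I' I'' g (f x)) (hf : MDifferentiableAt I I' f x)
    (h : Function.Injective (mfderiv I I'' (g ∘ f) x)) :
    Function.Injective (mfderiv I I' f x) := by
  rw [mfderiv_comp x hg hf] at h
  exact Function.Injective.of_comp h

theorem mfderiv_injective_of_leftInverse {f : M → M'} {g : M' → M} {x : M}
    (hg : MDifferentiableAt I' I g (f x)) (hf : MDifferentiableAt I I' f x)
    (h : ∀ y, g (f y) = y) : Function.Injective (mfderiv I I' f x) := by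
  refine mfderiv_injective_of_comp hg hf ?_
  have : g ∘ f = id := funext h
  rw [this, mfderiv_id]
  exact fun _ _ h => h

/-- Differentiating `f ∘ s = id` gives `D ∘ S = id`. The condition `s (f x) = x` is what makes the
differential of `f` at `x` itself appear. -/
theorem mfderiv_surjective_of_section {f : M → M'} {s : M' → M} {x : M}
    (hf : MDifferentiableAt I I' f x) (hs : MDifferentiableAt I' I s (f x))
    (h : ∀ y, f (s y) = y) (hx : s (f x) = x) : Function.Surjective (mfderiv I I' f x) := by
  have hfd := hf.hasMFDerivAt
  set D : E →L[ℝ] E' := mfderiv I I' f x with hD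
  set S : E' →L[ℝ] E := mfderiv I' I s (f x) with hS
  have h1 : HasMFDerivAt I' I' (f ∘ s) (f x) (D ∘L S) :=
    HasMFDerivAt.comp (f x) (by rw [hx]; exact hfd) hs.hasMFDerivAt
  rw [show f ∘ s = id from funext h] at h1
  have h2 : D ∘L S = ContinuousLinearMap.id ℝ E' := hasMFDerivAt_unique h1 (hasMFDerivAt_id (f x))
  exact fun v => ⟨S v, DFunLike.congr_fun h2 v⟩

/-- Transport of a manifold structure along a homeomorphism, with a change of the model space. -/
theorem exists_chartedSpace_of_homeomorph [I.Boundaryless] [IsManifold I ∞ M] {X : Type*}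
    [TopologicalSpace X] (h : X ≃ₜ M) (L : E ≃L[ℝ] E') :
    ∃ _ : ChartedSpace E' X, IsManifold 𝓘(ℝ, E') ∞ X ∧ ContMDiff 𝓘(ℝ, E') I ∞ h ∧
      ContMDiff I 𝓘(ℝ, E') ∞ h.symm := by
  -- Without boundary the model map `I` is a homeomorphism, so the old charts can be continued into
  -- `E'`; the new transition maps are the old ones conjugated by `L`.
  let k : H ≃ₜ E' := I.toHomeomorph.trans L.toHomeomorph
  let T : OpenPartialHomeomorph M H → OpenPartialHomeomorph X E' := fun c =>
    (h.toOpenPartialHomeomorph ≫ₕ c) ≫ₕ k.toOpenPartialHomeomorph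
  let C : ChartedSpace E' X :=
    { atlas := T '' atlas H M
      chartAt := fun x => T (chartAt H (h x))
      mem_chart_source := fun x => by simp [T]
      chart_mem_atlas := fun x => ⟨_, chart_mem_atlas H (h x), rfl⟩ }
  have hM : IsManifold 𝓘(ℝ, E') ∞ X := by
    refine isManifold_of_contDiffOn _ _ _ ?_
    rintro _ _ ⟨c, hc, rfl⟩ ⟨c', hc', rfl⟩
    have h1 : c.symm ≫ₕ c' ∈ contDiffGroupoid ∞ I := HasGroupoid.compatible hc hc'
    rw [contDiffGroupoid, mem_groupoid_of_pregroupoid] at h1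
    have h2 : ContDiffOn ℝ ∞ (I ∘ (c.symm ≫ₕ c') ∘ I.symm)
      (I.symm ⁻¹' (c.symm ≫ₕ c').source ∩ Set.range I) := h1.1
    have h3 := L.contDiff.comp_contDiffOn (h2.comp (L.symm.contDiff (n := ∞)).contDiffOn
      (Set.mapsTo_preimage L.symm _))
    refine (h3.congr ?_).mono ?_
    · intro z _
      simp [T, k]
    · intro z hz
      have hz1 : L.symm z ∈ Set.range I := by rw [I.range_eq_univ]; trivial
      exact ⟨by simpa [T, k] using hz, hz1⟩
  have hE : ∀ x y, extChartAt 𝓘(ℝ, E') x y = L (extChartAt I (h x) (h y)) := fun _ _ => rfl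
  have hE' : ∀ x z, (extChartAt 𝓘(ℝ, E') x).symm z =
    h.symm ((extChartAt I (h x)).symm (L.symm z)) := fun _ _ => rfl
  have hs : ∀ y : M, ContMDiffAt 𝓘(ℝ, E) I ∞ (extChartAt I y).symm (extChartAt I y y) := fun y =>
    (contMDiffOn_extChartAt_symm y).contMDiffAt (extChartAt_target_mem_nhds y)
  have hL : ContMDiff 𝓘(ℝ, E) 𝓘(ℝ, E') ∞ L := L.contDiff.contMDiff
  have hL' : ContMDiff 𝓘(ℝ, E') 𝓘(ℝ, E) ∞ L.symm := L.symm.contDiff.contMDiff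
  refine ⟨C, hM, fun x => ?_, fun y => ?_⟩
  · have hev : h =ᶠ[𝓝 x]
        (extChartAt I (h x)).symm ∘ L.symm ∘ extChartAt 𝓘(ℝ, E') x := by
      filter_upwards [h.continuous.continuousAt.eventually (extChartAt_source_mem_nhds (I := I) (h x))]
        with z hz
      simp only [Function.comp_apply, hE, L.symm_apply_apply]
      exact ((extChartAt I (h x)).left_inv hz).symm
    refine ContMDiffAt.congr_of_eventuallyEq ?_ hev
    refine ContMDiffAt.comp x ?_ (hL'.contMDiffAt.comp x contMDiffAt_extChartAt)
    simp only [Function.comp_apply, hE, L.symm_apply_apply]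
    exact hs (h x)
  · obtain ⟨x, rfl⟩ := h.surjective y
    have hev : h.symm =ᶠ[𝓝 (h x)]
        (extChartAt 𝓘(ℝ, E') x).symm ∘ L ∘ extChartAt I (h x) := by
      filter_upwards [extChartAt_source_mem_nhds (I := I) (h x)] with z hz
      simp only [Function.comp_apply, hE', L.symm_apply_apply]
      rw [(extChartAt I (h x)).left_inv hz]
    refine ContMDiffAt.congr_of_eventuallyEq ?_ hev
    refine ContMDiffAt.comp (h x) ?_ (hL.contMDiffAt.comp (h x) contMDiffAt_extChartAt)
    rw [Function.comp_apply, ← hE]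
    exact contMDiffAt_extChartAt_symm_self x

end

/-! ### Global coordinates of `Sp(1,1)` -/

/-- The group of unit quaternions. -/
abbrev UnitSphere : Type := Metric.sphere (0 : ℍ[ℝ]) 1

theorem UnitSphere.norm_eq (u : UnitSphere) : ‖(u : ℍ[ℝ])‖ = 1 := norm_eq_of_mem_sphere u

theorem UnitSphere.normSq_eq (u : UnitSphere) : Quaternion.normSq (u : ℍ[ℝ]) = 1 := by
  rw [Quaternion.normSq_eq_norm_mul_self, u.norm_eq, one_mul]

theorem UnitSphere.star_mul_self (u : UnitSphere) : star (u : ℍ[ℝ]) * u = 1 := by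
  rw [Quaternion.star_mul_self, u.normSq_eq, Quaternion.coe_one]

theorem UnitSphere.self_mul_star (u : UnitSphere) : (u : ℍ[ℝ]) * star (u : ℍ[ℝ]) = 1 := by
  rw [Quaternion.self_mul_star, u.normSq_eq, Quaternion.coe_one]

theorem self_mul_star_eq_smul (x : ℍ[ℝ]) : x * star x = (‖x‖ ^ 2) • (1 : ℍ[ℝ]) := by
  rw [Quaternion.self_mul_star, Quaternion.normSq_eq_norm_mul_self, ← sq,
    ← Quaternion.coe_mul_eq_smul, mul_one]

theorem star_mul_self_eq_smul (x : ℍ[ℝ]) : star x * x = (‖x‖ ^ 2) • (1 : ℍ[ℝ]) := by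
  rw [Quaternion.star_mul_self, Quaternion.normSq_eq_norm_mul_self, ← sq,
    ← Quaternion.coe_mul_eq_smul, mul_one]

instance : StarModule ℝ ℍ[ℝ] := ⟨fun r x => Quaternion.star_smul r x⟩

/-- The factor `(1 - |p|²)^(-1/2)`. -/
def boostFactor (p : ℍ[ℝ]) : ℝ := (√(1 - ‖p‖ ^ 2))⁻¹

theorem one_sub_norm_sq_pos (p : UnitBall) : 0 < 1 - ‖(p : ℍ[ℝ])‖ ^ 2 := by
  have := UnitBall.norm_lt p
  nlinarith [norm_nonneg (p : ℍ[ℝ])]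

theorem boostFactor_pos (p : UnitBall) : 0 < boostFactor p :=
  inv_pos.mpr (Real.sqrt_pos.mpr (one_sub_norm_sq_pos p))

theorem boostFactor_sq (p : UnitBall) : boostFactor p ^ 2 * (1 - ‖(p : ℍ[ℝ])‖ ^ 2) = 1 := by
  rw [boostFactor, inv_pow, Real.sq_sqrt (one_sub_norm_sq_pos p).le,
    inv_mul_cancel₀ (one_sub_norm_sq_pos p).ne']

/-- The matrix with coordinates `v, u, p`. -/
def coordMatrix (v u p : ℍ[ℝ]) : Matrix (Fin 2) (Fin 2) ℍ[ℝ] :=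
  !![boostFactor p • (star u * v), boostFactor p • (star u * star p * v);
    boostFactor p • (p * v), boostFactor p • v]

theorem diag_mem_Sp11 (u v : UnitSphere) : !![(u : ℍ[ℝ]), 0; 0, (v : ℍ[ℝ])] ∈ Sp11 := by
  change !![(u : ℍ[ℝ]), 0; 0, (v : ℍ[ℝ])]ᴴ * I11 * !![(u : ℍ[ℝ]), 0; 0, (v : ℍ[ℝ])] = I11
  ext i j : 1
  fin_cases i <;> fin_cases j <;>
    simp [Matrix.mul_apply, Fin.sum_univ_two, I11, UnitSphere.star_mul_self]

/-- Without the scalar, the off-diagonal terms cancel and the form is multiplied by 1 - |p|²; the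
square of the boost factor compensates. -/
theorem boost_mem_Sp11 (p : UnitBall) :
    boostFactor p • !![1, star (p : ℍ[ℝ]); (p : ℍ[ℝ]), 1] ∈ Sp11 := by
  have h := boostFactor_sq p
  change (boostFactor p • !![1, star (p : ℍ[ℝ]); (p : ℍ[ℝ]), 1])ᴴ * I11 *
    (boostFactor p • !![1, star (p : ℍ[ℝ]); (p : ℍ[ℝ]), 1]) = I11
  have e : (!![1, star (p : ℍ[ℝ]); (p : ℍ[ℝ]), 1])ᴴ * I11 * !![1, star (p : ℍ[ℝ]); (p : ℍ[ℝ]), 1] =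
      (1 - ‖(p : ℍ[ℝ])‖ ^ 2) • I11 := by
    ext i j : 1
    fin_cases i <;> fin_cases j <;>
      simp [Matrix.mul_apply, Fin.sum_univ_two, I11, star_mul_self_eq_smul, self_mul_star_eq_smul,
        add_smul, sub_eq_add_neg, add_comm]
  rw [Matrix.conjTranspose_smul, Matrix.smul_mul, Matrix.smul_mul, Matrix.mul_smul, e, smul_smul,
    smul_smul, star_trivial, ← sq, h, one_smul]

/-- The matrix is the product diag(u*, 1) · boost(p) · diag(v, v) of three elements of the group. -/
theorem coordMatrix_mem (v u : UnitSphere) (p : UnitBall) : coordMatrix v u p ∈ Sp11 := by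
  have hu : star (u : ℍ[ℝ]) ∈ Metric.sphere (0 : ℍ[ℝ]) 1 := by simp [u.norm_eq]
  have h := Sp11.mul_mem (Sp11.mul_mem (diag_mem_Sp11 ⟨_, hu⟩ 1) (boost_mem_Sp11 p))
    (diag_mem_Sp11 v v)
  convert h using 1
  ext i j : 1
  fin_cases i <;> fin_cases j <;> simp [coordMatrix, Matrix.mul_apply, Fin.sum_univ_two]

/-- The coordinate `d / |d|`. -/
def coordV (X : Matrix (Fin 2) (Fin 2) ℍ[ℝ]) : ℍ[ℝ] := ‖X 1 1‖⁻¹ • X 1 1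

/-- The coordinate `(a d⁻¹)*`. -/
def coordU (X : Matrix (Fin 2) (Fin 2) ℍ[ℝ]) : ℍ[ℝ] := (‖X 1 1‖ ^ 2)⁻¹ • (X 1 1 * star (X 0 0))

/-- The coordinate `b d⁻¹`. -/
def coordP (X : Matrix (Fin 2) (Fin 2) ℍ[ℝ]) : ℍ[ℝ] := (‖X 1 1‖ ^ 2)⁻¹ • (X 1 0 * star (X 1 1))

/-! ### Recovering a matrix of Sp(1,1) from its coordinates -/

section
variable {A : Matrix (Fin 2) (Fin 2) ℍ[ℝ]}

theorem Sp11.norm_d_pos (hA : A ∈ Sp11) : 0 < ‖A 1 1‖ :=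
  lt_of_le_of_lt (norm_nonneg _) (Sp11.norm_c_lt_d hA)

theorem Sp11.norm_a_eq (hA : A ∈ Sp11) : ‖A 0 0‖ = ‖A 1 1‖ := by
  have h0 := Sp11.row00 hA
  have h1 := Sp11.col11 hA
  rw [Quaternion.normSq_eq_norm_mul_self, Quaternion.normSq_eq_norm_mul_self] at h0 h1
  rw [← abs_of_nonneg (norm_nonneg (A 0 0)), ← abs_of_nonneg (norm_nonneg (A 1 1)),
    ← sq_eq_sq_iff_abs_eq_abs]
  linarith

theorem Sp11.norm_b_sq (hA : A ∈ Sp11) : ‖A 1 0‖ ^ 2 = ‖A 1 1‖ ^ 2 - 1 := by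
  have h0 := Sp11.col00 hA
  rw [Quaternion.normSq_eq_norm_mul_self, Quaternion.normSq_eq_norm_mul_self,
    Sp11.norm_a_eq hA] at h0
  linarith

theorem norm_coordV (hA : A ∈ Sp11) : ‖coordV A‖ = 1 := by
  rw [coordV, norm_smul, norm_inv, norm_norm, inv_mul_cancel₀ (Sp11.norm_d_pos hA).ne']

theorem norm_coordU (hA : A ∈ Sp11) : ‖coordU A‖ = 1 := by
  have := (Sp11.norm_d_pos hA).ne'
  rw [coordU, norm_smul, norm_mul, norm_star, norm_inv, norm_pow, norm_norm, Sp11.norm_a_eq hA]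
  field_simp

/-- Since |b|² = |d|² - 1, one has |bd⁻¹|² = 1 - |d|⁻². This puts bd⁻¹ in the ball and identifies
its boost factor with |d|. -/
theorem norm_coordP_sq (hA : A ∈ Sp11) : 1 - ‖coordP A‖ ^ 2 = (‖A 1 1‖ ^ 2)⁻¹ := by
  have := (Sp11.norm_d_pos hA).ne'
  rw [coordP, norm_smul, norm_mul, norm_star, norm_inv, norm_pow, norm_norm, mul_pow, mul_pow,
    Sp11.norm_b_sq hA]
  field_simp
  ring

theorem norm_coordP_lt (hA : A ∈ Sp11) : ‖coordP A‖ < 1 := by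
  have h := norm_coordP_sq hA
  have h1 : 0 < (‖A 1 1‖ ^ 2)⁻¹ := by
    have := Sp11.norm_d_pos hA
    positivity
  nlinarith [norm_nonneg (coordP A)]

theorem boostFactor_coordP (hA : A ∈ Sp11) : boostFactor (coordP A) = ‖A 1 1‖ := by
  rw [boostFactor, norm_coordP_sq hA, Real.sqrt_inv, Real.sqrt_sq (norm_nonneg _), inv_inv]

/-- The entries a, b, d come back from d*d = |d|². The entry c, which none of the coordinates
mentions, is determined by the row relation ab* = cd*. -/
theorem coordMatrix_coord (hA : A ∈ Sp11) : coordMatrix (coordV A) (coordU A) (coordP A) = A := by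
  have hn := (Sp11.norm_d_pos hA).ne'
  have hd := star_mul_self_eq_smul (A 1 1)
  have hr := Sp11.row01 hA
  have key : ∀ x : ℍ[ℝ], x * star (A 1 1) * A 1 1 = ‖A 1 1‖ ^ 2 • x := by
    intro x
    rw [mul_assoc, hd, mul_smul_comm, mul_one]
  rw [coordMatrix, boostFactor_coordP hA, coordV, coordU, coordP]
  set n := ‖A 1 1‖
  ext i j : 1
  fin_cases i <;> fin_cases j
  · simp only [star_smul, star_mul, star_star, star_trivial, smul_mul_assoc, mul_smul_comm, key,
      smul_smul, Matrix.of_apply, Matrix.cons_val', Matrix.cons_val_zero, Fin.zero_eta]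
    convert one_smul ℝ (A 0 0) using 2
    field_simp
  · have key2 : A 0 0 * star (A 1 1) * (A 1 1 * star (A 1 0)) * A 1 1 = (n ^ 2 * n ^ 2) • A 0 1 := by
      rw [← mul_assoc, key, smul_mul_assoc, smul_mul_assoc, hr, key, smul_smul]
    have : ((n • ((n ^ 2)⁻¹ • (A 0 0 * star (A 1 1)) * (n ^ 2)⁻¹ • (A 1 1 * star (A 1 0)) *
        n⁻¹ • A 1 1)) : ℍ[ℝ]) = A 0 1 := by
      simp only [smul_mul_assoc, mul_smul_comm, key2, smul_smul]
      convert one_smul ℝ (A 0 1) using 2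
      field_simp
    simpa using this
  · have : (n • ((n ^ 2)⁻¹ • (A 1 0 * star (A 1 1)) * n⁻¹ • A 1 1) : ℍ[ℝ]) = A 1 0 := by
      simp only [smul_mul_assoc, mul_smul_comm, key, smul_smul]
      convert one_smul ℝ (A 1 0) using 2
      field_simp
    simpa using this
  · simp [smul_smul, hn]

end

theorem coordV_coordMatrix (v u : UnitSphere) (p : UnitBall) :
    coordV (coordMatrix v u p) = v := by
  have h := boostFactor_pos p
  simp [coordV, coordMatrix, norm_smul, v.norm_eq, smul_smul, abs_of_pos h, h.ne']

theorem coordU_coordMatrix (v u : UnitSphere) (p : UnitBall) :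
    coordU (coordMatrix v u p) = u := by
  have h := boostFactor_pos p
  simp only [coordU, coordMatrix, Matrix.of_apply, Matrix.cons_val', Matrix.cons_val_zero,
    Matrix.cons_val_one, Matrix.cons_val_fin_one, star_smul, star_mul, star_star, star_trivial,
    smul_mul_assoc, mul_smul_comm, ← mul_assoc, v.self_mul_star, one_mul, smul_smul, norm_smul,
    v.norm_eq, mul_one, Real.norm_eq_abs, sq_abs]
  convert one_smul ℝ (u : ℍ[ℝ]) using 2
  field_simp

theorem coordP_coordMatrix (v u : UnitSphere) (p : UnitBall) :
    coordP (coordMatrix v u p) = p := by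
  have h := boostFactor_pos p
  simp only [coordP, coordMatrix, Matrix.of_apply, Matrix.cons_val', Matrix.cons_val_zero,
    Matrix.cons_val_one, Matrix.cons_val_fin_one, star_smul, star_trivial,
    smul_mul_assoc, mul_smul_comm, mul_assoc, v.self_mul_star, mul_one, smul_smul, norm_smul,
    v.norm_eq, Real.norm_eq_abs, sq_abs]
  convert one_smul ℝ (p : ℍ[ℝ]) using 2
  field_simp

/-- The matrix in `Sp(1,1)` with given coordinates. -/
def ofCoord (x : UnitSphere × UnitSphere × UnitBall) : Sp11 :=
  ⟨coordMatrix x.1 x.2.1 x.2.2, coordMatrix_mem x.1 x.2.1 x.2.2⟩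

theorem coordP_mem (A : Sp11) : coordP A.1 ∈ UnitBall := by
  change _ ∈ Metric.ball (0 : ℍ[ℝ]) 1
  rw [mem_ball_zero_iff]
  exact norm_coordP_lt A.2

theorem continuous_boostFactor : Continuous fun p : UnitBall => boostFactor p := by
  unfold boostFactor
  refine Continuous.inv₀ (by fun_prop) fun p => ?_
  exact (Real.sqrt_pos.mpr (one_sub_norm_sq_pos p)).ne'

theorem continuous_ofCoord : Continuous ofCoord := by
  refine Continuous.subtype_mk ?_ _
  have := continuous_boostFactor
  refine continuous_pi fun i => continuous_pi fun j => ?_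
  have h3 : Continuous fun x : UnitSphere × UnitSphere × UnitBall => boostFactor x.2.2 :=
    this.comp (by fun_prop)
  fin_cases i <;> fin_cases j <;> simp only [coordMatrix] <;>
    refine h3.smul ?_ <;> fun_prop

theorem continuous_coords : Continuous fun A : Sp11 =>
    ((⟨coordV A.1, mem_sphere_zero_iff_norm.mpr (norm_coordV A.2)⟩,
      ⟨coordU A.1, mem_sphere_zero_iff_norm.mpr (norm_coordU A.2)⟩, ⟨coordP A.1, coordP_mem A⟩) :
      UnitSphere × UnitSphere × UnitBall) := by
  have h : ∀ i j, Continuous fun A : Sp11 => A.1 i j := fun i j =>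
    (continuous_apply j).comp ((continuous_apply i).comp continuous_subtype_val)
  have hn : ∀ A : Sp11, ‖A.1 1 1‖ ≠ 0 := fun A => (Sp11.norm_d_pos A.2).ne'
  have hn2 : Continuous fun A : Sp11 => (‖A.1 1 1‖ ^ 2)⁻¹ :=
    ((h 1 1).norm.pow 2).inv₀ fun A => pow_ne_zero 2 (hn A)
  refine Continuous.prodMk (Continuous.subtype_mk (f := fun A : Sp11 => coordV A.1) ?_ _)
    (Continuous.prodMk (Continuous.subtype_mk (f := fun A : Sp11 => coordU A.1) ?_ _)
      (Continuous.subtype_mk (f := fun A : Sp11 => coordP A.1) ?_ _))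
  · exact ((h 1 1).norm.inv₀ hn).smul (h 1 1)
  · exact hn2.smul ((h 1 1).mul (h 0 0).star)
  · exact hn2.smul ((h 1 0).mul (h 1 1).star)

/-- The coordinates `(d / |d|, (a d⁻¹)*, b d⁻¹)` identify `Sp(1,1)` with `Sp(1) × Sp(1) × 𝔹`. -/
def spCoord : Sp11 ≃ₜ UnitSphere × UnitSphere × UnitBall where
  toFun A := (⟨coordV A.1, mem_sphere_zero_iff_norm.mpr (norm_coordV A.2)⟩,
    ⟨coordU A.1, mem_sphere_zero_iff_norm.mpr (norm_coordU A.2)⟩, ⟨coordP A.1, coordP_mem A⟩)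
  invFun := ofCoord
  left_inv A := Subtype.ext (coordMatrix_coord A.2)
  right_inv x := Prod.ext (Subtype.ext (coordV_coordMatrix _ _ _))
    (Prod.ext (Subtype.ext (coordU_coordMatrix _ _ _)) (Subtype.ext (coordP_coordMatrix _ _ _)))
  continuous_toFun := by
    exact continuous_coords
  continuous_invFun := continuous_ofCoord

theorem spCoord_symm_apply (x : UnitSphere × UnitSphere × UnitBall) :
    spCoord.symm x = ofCoord x := rfl

/-! ### Global coordinates of the regular Möbius transformations -/

/-- Here `T` is the value at `q` of the regular reciprocal of 1 - qp*. The right-hand side does not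
involve `v`, which is why the transformation depends only on (u, p). -/
theorem toRegularMobius_ofCoord_apply (v u : UnitSphere) (p q : UnitBall) {T : ℍ[ℝ]}
    (hT : T - (q : ℍ[ℝ]) * T * star (p : ℍ[ℝ]) = 1) :
    (toRegularMobius (ofCoord (v, u, p)) q : ℍ[ℝ]) = ((q : ℍ[ℝ]) * T - T * p) * u := by
  have hr := (boostFactor_pos p).ne'
  have hv := v.self_mul_star
  change mobiusVal (((ofCoord (v, u, p))⁻¹ : Sp11) : Matrix (Fin 2) (Fin 2) ℍ[ℝ]) q = _
  have hinv : (((ofCoord (v, u, p))⁻¹ : Sp11) : Matrix (Fin 2) (Fin 2) ℍ[ℝ]) =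
      !![boostFactor p • (star (v : ℍ[ℝ]) * u), -(boostFactor p • (star (v : ℍ[ℝ]) * star (p : ℍ[ℝ])));
        -(boostFactor p • (star (v : ℍ[ℝ]) * p * u)), boostFactor p • star (v : ℍ[ℝ])] := by
    change I11 * (coordMatrix v u p)ᴴ * I11 = _
    ext i j : 1
    fin_cases i <;> fin_cases j <;>
      simp [I11, coordMatrix, Matrix.mul_apply, Fin.sum_univ_two, mul_assoc, Matrix.vecMul,
        dotProduct]
  have hk : ∀ x : ℍ[ℝ], x * v * star (v : ℍ[ℝ]) = x := fun x => by rw [mul_assoc, hv, mul_one]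
  -- For the entries c, d of the inverse matrix, the equation Sd + qSc = 1 becomes the equation for
  -- `T` once S = r⁻¹Tv, since vv* = 1.
  rw [Sp11.mobiusVal_eq (ofCoord (v, u, p))⁻¹.2 q (S := (boostFactor p)⁻¹ • (T * v)), hinv]
  · simp only [Matrix.of_apply, Matrix.cons_val', Matrix.cons_val_zero, Matrix.cons_val_one,
      Matrix.cons_val_fin_one, mul_neg, smul_mul_assoc, mul_smul_comm, smul_smul, ← mul_assoc, hk,
      mul_inv_cancel₀ hr, one_smul, sub_mul]
    abel
  · rw [hinv]
    simp only [Matrix.of_apply, Matrix.cons_val', Matrix.cons_val_zero, Matrix.cons_val_one,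
      Matrix.cons_val_fin_one, mul_neg, smul_mul_assoc, mul_smul_comm, smul_smul, ← mul_assoc, hk,
      mul_inv_cancel₀ hr, one_smul]
    rw [← hT]
    abel

theorem exists_kernel (p q : UnitBall) : ∃ T : ℍ[ℝ], T - (q : ℍ[ℝ]) * T * star (p : ℍ[ℝ]) = 1 := by
  obtain ⟨-, h⟩ := starInv_lin (c := -star (p : ℍ[ℝ])) (d := 1)
    (by simpa using UnitBall.norm_lt p)
  refine ⟨starInv (lin (-star (p : ℍ[ℝ])) 1) q, ?_⟩
  simpa [sub_eq_add_neg] using h q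

/-- At q = p the kernel is the real number (1 - |p|²)⁻¹, which commutes with p, so qT - Tp vanishes.
-/
theorem toRegularMobius_ofCoord_zero (v u : UnitSphere) (p : UnitBall) :
    toRegularMobius (ofCoord (v, u, p)) p = origin := by
  apply Subtype.ext
  have h := (one_sub_norm_sq_pos p).ne'
  rw [toRegularMobius_ofCoord_apply v u p p (T := (1 - ‖(p : ℍ[ℝ])‖ ^ 2)⁻¹ • 1)]
  · simp [origin]
  · rw [mul_smul_comm, mul_one, smul_mul_assoc, self_mul_star_eq_smul, smul_smul,
      ← sub_smul, ← mul_one_sub, inv_mul_cancel₀ h, one_smul]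

theorem inverseOrbit_eq_iff (F : RegularMobius) (p : UnitBall) :
    inverseOrbit F = p ↔ F p = origin := by
  rw [inverseOrbit, Equiv.symm_apply_eq, eq_comm]
  rfl

/-- The regular Möbius transformation `(1 - q p*)⁻* * (q - p) u`. -/
def mobiusOfCoord (x : UnitSphere × UnitBall) : RegularMobius := toRegularMobius (ofCoord (1, x))

theorem toRegularMobius_ofCoord (x : UnitSphere × UnitSphere × UnitBall) :
    toRegularMobius (ofCoord x) = mobiusOfCoord x.2 := by
  refine RegularMobius.ext fun q => Subtype.ext ?_
  obtain ⟨T, hT⟩ := exists_kernel x.2.2 q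
  exact (toRegularMobius_ofCoord_apply x.1 x.2.1 x.2.2 q hT).trans
    (toRegularMobius_ofCoord_apply 1 x.2.1 x.2.2 q hT).symm

theorem toRegularMobius_surjective : Function.Surjective toRegularMobius := by
  rintro ⟨F, A, rfl⟩
  exact ⟨A⁻¹, Subtype.ext (by simp [toRegularMobius])⟩

theorem inverseOrbit_mobiusOfCoord (x : UnitSphere × UnitBall) :
    inverseOrbit (mobiusOfCoord x) = x.2 :=
  (inverseOrbit_eq_iff _ _).mpr (toRegularMobius_ofCoord_zero _ _ _)

/-- The point p is recovered as the zero of the transformation, and u by cancelling qT - Tp at any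
point q where the value is not zero. -/
theorem mobiusOfCoord_injective : Function.Injective mobiusOfCoord := by
  rintro ⟨u, p⟩ ⟨u', p'⟩ h
  have hp : p = p' := by
    have := congrArg inverseOrbit h
    rwa [inverseOrbit_mobiusOfCoord, inverseOrbit_mobiusOfCoord] at this
  subst hp
  -- Surjectivity provides a point with value 1/2; any nonzero value would do.
  obtain ⟨q, hq⟩ : ∃ q : UnitBall, mobiusOfCoord (u, p) q ≠ origin := by
    obtain ⟨q, hq⟩ := (mobiusOfCoord (u, p)).bijective.2
      ⟨((1 / 2 : ℝ) : ℍ[ℝ]), by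
        change _ ∈ Metric.ball (0 : ℍ[ℝ]) 1
        rw [mem_ball_zero_iff, Quaternion.norm_coe]
        norm_num⟩
    refine ⟨q, fun h0 => ?_⟩
    rw [hq] at h0
    have := congrArg (fun z : UnitBall => ‖(z : ℍ[ℝ])‖) h0
    simp [origin] at this
  obtain ⟨T, hT⟩ := exists_kernel p q
  have h1 : (mobiusOfCoord (u, p) q : ℍ[ℝ]) = _ := toRegularMobius_ofCoord_apply 1 u p q hT
  have h2 : (mobiusOfCoord (u', p) q : ℍ[ℝ]) = _ := toRegularMobius_ofCoord_apply 1 u' p q hT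
  have hne : (q : ℍ[ℝ]) * T - T * p ≠ 0 := by
    intro h0
    rw [h0, zero_mul] at h1
    exact hq (Subtype.ext h1)
  rw [← h, h1] at h2
  exact Prod.ext (Subtype.ext (mul_left_cancel₀ hne h2)) rfl

theorem mobiusOfCoord_surjective : Function.Surjective mobiusOfCoord := by
  intro F
  obtain ⟨A, rfl⟩ := toRegularMobius_surjective F
  obtain ⟨x, rfl⟩ := spCoord.symm.surjective A
  exact ⟨x.2, (toRegularMobius_ofCoord x).symm⟩

/-- The bijection of `𝓜(𝔹)` with `Sp(1) × 𝔹`. -/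
def mobEquiv : RegularMobius ≃ UnitSphere × UnitBall :=
  (Equiv.ofBijective mobiusOfCoord ⟨mobiusOfCoord_injective, mobiusOfCoord_surjective⟩).symm

theorem mobEquiv_symm_apply (x : UnitSphere × UnitBall) : mobEquiv.symm x = mobiusOfCoord x := rfl

theorem mobEquiv_toRegularMobius (A : Sp11) :
    mobEquiv (toRegularMobius A) = (spCoord A).2 := by
  rw [← Equiv.eq_symm_apply, mobEquiv_symm_apply, ← toRegularMobius_ofCoord (spCoord A),
    ← spCoord_symm_apply, Homeomorph.symm_apply_apply]

/-- The coordinates of `𝓜(𝔹)`. -/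
def mobCoord : RegularMobius ≃ₜ UnitSphere × UnitBall where
  toEquiv := mobEquiv
  continuous_toFun := by
    refine continuous_coinduced_dom.mpr ?_
    have : mobEquiv ∘ toRegularMobius = fun A => (spCoord A).2 := funext mobEquiv_toRegularMobius
    change Continuous (mobEquiv ∘ toRegularMobius)
    rw [this]
    exact continuous_snd.comp spCoord.continuous
  continuous_invFun := by
    -- The inverse lifts to Sp(1,1) through the section v = 1.
    change Continuous (toRegularMobius ∘ fun x : UnitSphere × UnitBall => ofCoord (1, x))
    exact continuous_coinduced_rng.comp (continuous_ofCoord.comp (by fun_prop))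

theorem mobCoord_toRegularMobius (A : Sp11) : mobCoord (toRegularMobius A) = (spCoord A).2 :=
  mobEquiv_toRegularMobius A

theorem mobCoord_symm_apply (x : UnitSphere × UnitBall) : mobCoord.symm x = mobiusOfCoord x := rfl

theorem inverseOrbit_eq (F : RegularMobius) : inverseOrbit F = (mobCoord F).2 := by
  obtain ⟨x, rfl⟩ := mobCoord.symm.surjective F
  rw [Homeomorph.apply_symm_apply, mobCoord_symm_apply, inverseOrbit_mobiusOfCoord]

/-! ### Coordinates of the isotropy and the orbit space -/

theorem mobiusOfCoord_origin (u : UnitSphere) : mobiusOfCoord (u, origin) origin = origin :=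
  toRegularMobius_ofCoord_zero _ _ _

theorem mobCoord_incl (g : Isotropy) : (mobCoord g.incl).2 = origin := by
  rw [← inverseOrbit_eq, inverseOrbit_eq_iff]
  exact g.map_origin

/-- The isotropy is identified with the group of unit quaternions. -/
def isoCoord : Isotropy ≃ₜ UnitSphere where
  toFun g := (mobCoord g.incl).1
  invFun u := ⟨mobiusOfCoord (u, origin), mobiusOfCoord_origin u⟩
  left_inv g := by
    refine Subtype.ext ?_
    change mobiusOfCoord ((mobCoord g.incl).1, origin) = g.incl
    rw [← mobCoord_incl g, ← mobCoord_symm_apply, Prod.mk.eta, Homeomorph.symm_apply_apply]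
  right_inv u := by
    change (mobCoord (mobCoord.symm (u, origin))).1 = u
    rw [Homeomorph.apply_symm_apply]
  continuous_toFun := continuous_fst.comp (mobCoord.continuous.comp continuous_induced_dom)
  continuous_invFun := by
    refine continuous_induced_rng.mpr ?_
    change Continuous fun u => mobCoord.symm (u, origin)
    exact mobCoord.symm.continuous.comp (by fun_prop)

theorem mobCoord_incl_eq (g : Isotropy) : mobCoord g.incl = (isoCoord g, origin) :=
  Prod.ext rfl (mobCoord_incl g)

theorem Isotropy.apply_eq (g : Isotropy) (q : UnitBall) :
    (g q : ℍ[ℝ]) = (q : ℍ[ℝ]) * isoCoord g := by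
  have h : g.incl = mobiusOfCoord (isoCoord g, origin) := by
    rw [← mobCoord_symm_apply, ← mobCoord_incl_eq, Homeomorph.symm_apply_apply]
  rw [h]
  exact (toRegularMobius_ofCoord_apply 1 _ origin q (T := 1) (by simp [origin])).trans
    (by simp [origin])

/-- An isotropy element multiplies values on the right by its unit quaternion, and the value formula
ends with the factor u. -/
theorem mobCoord_smul (g : Isotropy) (F : RegularMobius) :
    mobCoord (g • F) = ((mobCoord F).1 * isoCoord g, (mobCoord F).2) := by
  obtain ⟨⟨u, p⟩, rfl⟩ := mobCoord.symm.surjective F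
  rw [← Homeomorph.eq_symm_apply, Homeomorph.apply_symm_apply]
  refine RegularMobius.ext fun q => Subtype.ext ?_
  obtain ⟨T, hT⟩ := exists_kernel p q
  rw [Isotropy.smul_apply, Isotropy.apply_eq]
  refine (congrArg (· * (isoCoord g : ℍ[ℝ])) (toRegularMobius_ofCoord_apply 1 u p q hT)).trans ?_
  rw [mul_assoc]
  exact (toRegularMobius_ofCoord_apply 1 (u * isoCoord g) p q hT).symm

/-- Composing on the left multiplies values on the right, so the coordinate is an anti-isomorphism
onto Sp(1). -/
theorem isoCoord_mul (g h : Isotropy) : isoCoord (g * h) = isoCoord h * isoCoord g :=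
  congrArg Prod.fst (mobCoord_smul g h.incl)

theorem isoCoord_one : isoCoord 1 = 1 := by
  have h := isoCoord_mul 1 1
  rw [mul_one] at h
  exact left_eq_mul.mp h

theorem isoCoord_inv (g : Isotropy) : isoCoord g⁻¹ = (isoCoord g)⁻¹ := by
  rw [eq_inv_iff_mul_eq_one, ← isoCoord_mul, mul_inv_cancel, isoCoord_one]

/-- The action fixes p and is transitive on the factor Sp(1), so each orbit is a whole fibre over p.
-/
theorem orbitProj_eq_iff (F G : RegularMobius) :
    orbitProj F = orbitProj G ↔ inverseOrbit F = inverseOrbit G := by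
  rw [orbitProj, orbitProj, Quotient.eq]
  change F ∈ MulAction.orbit Isotropy G ↔ _
  rw [inverseOrbit_eq, inverseOrbit_eq]
  constructor
  · rintro ⟨g, hg⟩
    rw [← hg]
    change (mobCoord (g • G)).2 = _
    rw [mobCoord_smul]
  · intro h
    refine ⟨isoCoord.symm ((mobCoord G).1⁻¹ * (mobCoord F).1), mobCoord.injective ?_⟩
    change mobCoord (_ • G) = _
    rw [mobCoord_smul, Homeomorph.apply_symm_apply, mul_inv_cancel_left, ← h]

theorem continuous_inverseOrbit : Continuous inverseOrbit := by
  rw [show inverseOrbit = fun F => (mobCoord F).2 from funext inverseOrbit_eq]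
  exact continuous_snd.comp mobCoord.continuous

/-- The identification of the orbit space with the unit ball, `𝓜(𝔹)₀ 𝓕 ↦ 𝓕⁻¹(0)`. -/
def orbCoord : OrbitSpace ≃ₜ UnitBall where
  toFun := Quotient.lift inverseOrbit fun F G h => (orbitProj_eq_iff F G).mp (Quotient.sound h)
  invFun p := orbitProj (mobiusOfCoord (1, p))
  left_inv := by
    rintro ⟨F⟩
    refine (orbitProj_eq_iff _ F).mpr ?_
    rw [inverseOrbit_mobiusOfCoord]
  right_inv p := inverseOrbit_mobiusOfCoord _
  continuous_toFun := continuous_inverseOrbit.quotient_lift _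
  continuous_invFun := by
    refine continuous_quotient_mk'.comp ?_
    change Continuous fun p => mobCoord.symm (1, p)
    exact mobCoord.symm.continuous.comp (by fun_prop)

theorem orbCoord_orbitProj (F : RegularMobius) : orbCoord (orbitProj F) = inverseOrbit F := rfl

/-! ### The action is free and proper -/

instance : T2Space RegularMobius := mobCoord.symm.t2Space

instance : SecondCountableTopology RegularMobius := mobCoord.secondCountableTopology

theorem smul_free (g : Isotropy) (F : RegularMobius) (h : g • F = F) : g = 1 := by
  have h1 := congrArg Prod.fst (mobCoord_smul g F)
  rw [h] at h1
  apply isoCoord.injective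
  rw [isoCoord_one]
  exact left_eq_mul.mp h1

theorem continuous_smul_isotropy :
    Continuous fun p : Isotropy × RegularMobius => p.1 • p.2 := by
  have e : (fun p : Isotropy × RegularMobius => p.1 • p.2) = fun p =>
      mobCoord.symm ((mobCoord p.2).1 * isoCoord p.1, (mobCoord p.2).2) := by
    funext p
    rw [Homeomorph.eq_symm_apply, mobCoord_smul]
  rw [e]
  have h1 := mobCoord.continuous
  have h2 := isoCoord.continuous
  refine mobCoord.symm.continuous.comp ?_
  fun_prop

instance : CompactSpace Isotropy := isoCoord.symm.compactSpace

/-- The isotropy is compact, so the set is the projection of a closed subset of the compact product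
of the isotropy with `K`. -/
theorem smul_proper (K : Set RegularMobius) (hK : IsCompact K) :
    IsCompact {g : Isotropy | (((fun F => g • F) '' K) ∩ K).Nonempty} := by
  have h : {g : Isotropy | (((fun F => g • F) '' K) ∩ K).Nonempty} = Prod.fst ''
      ((Set.univ ×ˢ K) ∩ (fun p : Isotropy × RegularMobius => p.1 • p.2) ⁻¹' K) := by
    ext g
    constructor
    · rintro ⟨_, ⟨F, hF, rfl⟩, hgF⟩
      exact ⟨(g, F), ⟨⟨trivial, hF⟩, hgF⟩, rfl⟩
    · rintro ⟨⟨g, F⟩, ⟨⟨-, hF⟩, hgF⟩, rfl⟩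
      exact ⟨_, ⟨F, hF, rfl⟩, hgF⟩
  rw [h]
  exact ((isCompact_univ.prod hK).inter_right
    (hK.isClosed.preimage continuous_smul_isotropy)).image continuous_fst

/-! ### Smoothness of the coordinates -/

/-- Equips the unit quaternions with their sphere charts in dimension 3. -/
instance : Fact (Module.finrank ℝ ℍ[ℝ] = 3 + 1) := ⟨Quaternion.finrank_eq_four⟩

/-- The model of `Sp(1) × 𝔹`. -/
abbrev mobModel := (𝓡 3).prod 𝓘(ℝ, ℍ[ℝ])

/-- The model of `Sp(1) × Sp(1) × 𝔹`. -/
abbrev spModel := (𝓡 3).prod mobModel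

theorem contDiff_star_quaternion : ContDiff ℝ ∞ (star : ℍ[ℝ] → ℍ[ℝ]) :=
  (starL' ℝ : ℍ[ℝ] ≃L[ℝ] ℍ[ℝ]).contDiff

theorem contDiffAt_boostFactor (p : UnitBall) : ContDiffAt ℝ ∞ boostFactor (p : ℍ[ℝ]) := by
  unfold boostFactor
  have h := one_sub_norm_sq_pos p
  refine ContDiffAt.inv (ContDiffAt.sqrt ?_ h.ne') (Real.sqrt_pos.mpr h).ne'
  exact contDiffAt_const.sub (contDiff_norm_sq ℝ).contDiffAt

section
variable {E H M : Type*} [NormedAddCommGroup E] [NormedSpace ℝ E] [TopologicalSpace H]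
  {I : ModelWithCorners ℝ E H} [TopologicalSpace M] [ChartedSpace H M]

theorem contMDiff_quaternion_mul {f g : M → ℍ[ℝ]} (hf : ContMDiff I 𝓘(ℝ, ℍ[ℝ]) ∞ f)
    (hg : ContMDiff I 𝓘(ℝ, ℍ[ℝ]) ∞ g) : ContMDiff I 𝓘(ℝ, ℍ[ℝ]) ∞ fun x => f x * g x :=
  (contDiff_mul (𝕜 := ℝ) (𝔸 := ℍ[ℝ])).comp_contMDiff (hf.prodMk_space hg)

theorem contMDiff_quaternion_star {f : M → ℍ[ℝ]} (hf : ContMDiff I 𝓘(ℝ, ℍ[ℝ]) ∞ f) :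
    ContMDiff I 𝓘(ℝ, ℍ[ℝ]) ∞ fun x => star (f x) :=
  contDiff_star_quaternion.comp_contMDiff hf

theorem contMDiff_unitSphere_iff [IsManifold I ∞ M] {f : M → UnitSphere} :
    ContMDiff I (𝓡 3) ∞ f ↔ ContMDiff I 𝓘(ℝ, ℍ[ℝ]) ∞ fun x => (f x : ℍ[ℝ]) := by
  constructor
  · intro h
    exact contMDiff_coe_sphere.comp h
  · intro h
    exact h.codRestrict_sphere fun x => (f x).2

theorem contMDiff_unitBall_iff {f : M → UnitBall} :
    ContMDiff I 𝓘(ℝ, ℍ[ℝ]) ∞ f ↔ ContMDiff I 𝓘(ℝ, ℍ[ℝ]) ∞ fun x => (f x : ℍ[ℝ]) :=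
  (ContMDiff.subtypeVal_comp_iff UnitBall f).symm

theorem contMDiff_unitSphere_mul [IsManifold I ∞ M] {f g : M → UnitSphere}
    (hf : ContMDiff I (𝓡 3) ∞ f) (hg : ContMDiff I (𝓡 3) ∞ g) :
    ContMDiff I (𝓡 3) ∞ fun x => f x * g x := by
  rw [contMDiff_unitSphere_iff] at *
  exact contMDiff_quaternion_mul hf hg

theorem contMDiff_unitSphere_inv [IsManifold I ∞ M] {f : M → UnitSphere}
    (hf : ContMDiff I (𝓡 3) ∞ f) : ContMDiff I (𝓡 3) ∞ fun x => (f x)⁻¹ := by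
  rw [contMDiff_unitSphere_iff] at *
  convert contMDiff_quaternion_star hf using 2 with x
  exact inv_eq_of_mul_eq_one_left (f x).star_mul_self

end

theorem mfderiv_coe_unitSphere_injective (u : UnitSphere) :
    Function.Injective (mfderiv (𝓡 3) 𝓘(ℝ, ℍ[ℝ]) (Subtype.val : UnitSphere → ℍ[ℝ]) u) :=
  injective_mvfderiv_subtypeVal_sphere u

open Classical in
theorem mfderiv_coe_unitBall_injective (p : UnitBall) :
    Function.Injective (mfderiv 𝓘(ℝ, ℍ[ℝ]) 𝓘(ℝ, ℍ[ℝ]) (Subtype.val : UnitBall → ℍ[ℝ]) p) := by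
  -- The value outside the ball is irrelevant: `g` is only needed near `p`, and the ball is open.
  let g : ℍ[ℝ] → UnitBall := fun x => if h : x ∈ UnitBall then ⟨x, h⟩ else origin
  have hg : ∀ q : UnitBall, g q = q := fun q => dif_pos q.2
  have hgs : ContMDiffAt 𝓘(ℝ, ℍ[ℝ]) 𝓘(ℝ, ℍ[ℝ]) ∞ g p := by
    rw [← ContMDiffAt.subtypeVal_comp_iff]
    refine contMDiffAt_id.congr_of_eventuallyEq ?_
    filter_upwards [UnitBall.2.mem_nhds p.2] with x hx
    exact congrArg Subtype.val (hg ⟨x, hx⟩)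
  exact mfderiv_injective_of_leftInverse (hgs.mdifferentiableAt (by simp))
    (contMDiff_subtype_val.contMDiffAt.mdifferentiableAt (n := ∞) (by simp)) hg

theorem contMDiff_coordMatrix :
    ContMDiff spModel 𝓘(ℝ, Fin 2 → Fin 2 → ℍ[ℝ]) ∞ (Sp11.incl ∘ ofCoord) := by
  have hv : ContMDiff spModel 𝓘(ℝ, ℍ[ℝ]) ∞
      fun x : UnitSphere × UnitSphere × UnitBall => (x.1 : ℍ[ℝ]) :=
    contMDiff_coe_sphere.comp contMDiff_fst
  have hu : ContMDiff spModel 𝓘(ℝ, ℍ[ℝ]) ∞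
      fun x : UnitSphere × UnitSphere × UnitBall => (x.2.1 : ℍ[ℝ]) :=
    contMDiff_coe_sphere.comp (contMDiff_fst.comp contMDiff_snd)
  have hp : ContMDiff spModel 𝓘(ℝ, ℍ[ℝ]) ∞
      fun x : UnitSphere × UnitSphere × UnitBall => (x.2.2 : ℍ[ℝ]) :=
    contMDiff_subtype_val.comp (contMDiff_snd.comp contMDiff_snd)
  have hr : ContMDiff spModel 𝓘(ℝ, ℝ) ∞
      fun x : UnitSphere × UnitSphere × UnitBall => boostFactor x.2.2 :=
    fun x => ContDiffAt.comp_contMDiffAt (g := boostFactor)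
      (f := fun y : UnitSphere × UnitSphere × UnitBall => (y.2.2 : ℍ[ℝ]))
      (contDiffAt_boostFactor x.2.2) (hp x)
  have hu' := contMDiff_quaternion_star hu
  refine contMDiff_pi_space.mpr fun i => contMDiff_pi_space.mpr fun j => ?_
  fin_cases i <;> fin_cases j
  · exact hr.smul (contMDiff_quaternion_mul hu' hv)
  · exact hr.smul (contMDiff_quaternion_mul
      (contMDiff_quaternion_mul hu' (contMDiff_quaternion_star hp)) hv)
  · exact hr.smul (contMDiff_quaternion_mul hp hv)
  · exact hr.smul hv

/-! ### The coordinates as smooth functions on matrices with d ≠ 0 -/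

section
variable {X : Fin 2 → Fin 2 → ℍ[ℝ]}

theorem contDiff_entry (i j : Fin 2) : ContDiff ℝ ∞ fun X : Fin 2 → Fin 2 → ℍ[ℝ] => X i j :=
  contDiff_apply_apply ℝ ℍ[ℝ] i j

theorem contDiffAt_inv_norm_sq (h : X 1 1 ≠ 0) :
    ContDiffAt ℝ ∞ (fun X : Fin 2 → Fin 2 → ℍ[ℝ] => (‖X 1 1‖ ^ 2)⁻¹) X :=
  (((contDiff_norm_sq ℝ).comp (contDiff_entry 1 1)).contDiffAt).inv
    (pow_ne_zero 2 (norm_ne_zero_iff.mpr h))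

theorem contDiffAt_coordV (h : X 1 1 ≠ 0) :
    ContDiffAt ℝ ∞ (fun X : Fin 2 → Fin 2 → ℍ[ℝ] => coordV X) X :=
  (((contDiff_entry 1 1).contDiffAt.norm ℝ h).inv (norm_ne_zero_iff.mpr h)).smul
    (contDiff_entry 1 1).contDiffAt

theorem contDiffAt_coordU (h : X 1 1 ≠ 0) :
    ContDiffAt ℝ ∞ (fun X : Fin 2 → Fin 2 → ℍ[ℝ] => coordU X) X :=
  (contDiffAt_inv_norm_sq h).smul ((contDiff_entry 1 1).contDiffAt.mul
    (contDiff_star_quaternion.comp (contDiff_entry 0 0)).contDiffAt)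

theorem contDiffAt_coordP (h : X 1 1 ≠ 0) :
    ContDiffAt ℝ ∞ (fun X : Fin 2 → Fin 2 → ℍ[ℝ] => coordP X) X :=
  (contDiffAt_inv_norm_sq h).smul ((contDiff_entry 1 0).contDiffAt.mul
    (contDiff_star_quaternion.comp (contDiff_entry 1 1)).contDiffAt)

end

theorem Sp11.incl_ne_zero (A : Sp11) : Sp11.incl A 1 1 ≠ 0 :=
  norm_pos_iff.mp (Sp11.norm_d_pos A.2)

section
variable {E E' E'' E₃ : Type*} [NormedAddCommGroup E] [NormedSpace ℝ E]
  [NormedAddCommGroup E'] [NormedSpace ℝ E'] [NormedAddCommGroup E''] [NormedSpace ℝ E'']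
  [NormedAddCommGroup E₃] [NormedSpace ℝ E₃]
  {H H' H'' H₃ : Type*} [TopologicalSpace H] [TopologicalSpace H'] [TopologicalSpace H'']
  [TopologicalSpace H₃] {I : ModelWithCorners ℝ E H} {I' : ModelWithCorners ℝ E' H'}
  {I'' : ModelWithCorners ℝ E'' H''} {I₃ : ModelWithCorners ℝ E₃ H₃}
  {M M' M'' M₃ : Type*} [TopologicalSpace M] [ChartedSpace H M] [TopologicalSpace M']
  [ChartedSpace H' M'] [TopologicalSpace M''] [ChartedSpace H'' M''] [TopologicalSpace M₃]
  [ChartedSpace H₃ M₃]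

/-- Both sides of g ∘ f = e ∘ c have the same differential, and that of `e` is injective. This
replaces a smooth left inverse of `f`: off Sp(1,1) the matrix functions `coordU` and `coordP` need
not land in the sphere or the ball, so they are compared after inclusion in ℍ. -/
theorem mfderiv_apply_eq_of_comp_eq {f : M → M'} {g : M' → M''} {c : M → M₃} {e : M₃ → M''} {x : M}
    {c' : E →L[ℝ] E₃}
    (hf : MDifferentiableAt I I' f x) (hg : MDifferentiableAt I' I'' g (f x))
    (hc : HasMFDerivAt I I₃ c x c') (he : MDifferentiableAt I₃ I'' e (c x))
    (hei : Function.Injective (mfderiv I₃ I'' e (c x))) (h : ∀ y, g (f y) = e (c y)) {v w : E}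
    (hvw : (mfderiv I I' f x : E → E') v = (mfderiv I I' f x : E → E') w) : c' v = c' w := by
  set D : E →L[ℝ] E' := mfderiv I I' f x
  set G : E' →L[ℝ] E'' := mfderiv I' I'' g (f x)
  set K : E₃ →L[ℝ] E'' := mfderiv I₃ I'' e (c x)
  have h1 : HasMFDerivAt I I'' (g ∘ f) x (G ∘L D) := hg.hasMFDerivAt.comp x hf.hasMFDerivAt
  have h2 : HasMFDerivAt I I'' (e ∘ c) x (K ∘L c') := he.hasMFDerivAt.comp x hc
  rw [show g ∘ f = e ∘ c from funext h] at h1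
  have h3 : G ∘L D = K ∘L c' := hasMFDerivAt_unique h1 h2
  refine hei ?_
  have hv : G (D v) = K (c' v) := DFunLike.congr_fun h3 v
  have hw : G (D w) = K (c' w) := DFunLike.congr_fun h3 w
  exact hv.symm.trans ((congrArg G hvw).trans hw)

end

theorem mfderiv_coordMatrix_injective (x : UnitSphere × UnitSphere × UnitBall) :
    Function.Injective
      (mfderiv spModel 𝓘(ℝ, Fin 2 → Fin 2 → ℍ[ℝ]) (Sp11.incl ∘ ofCoord) x) := by
  have hf := (contMDiff_coordMatrix x).mdifferentiableAt (by simp)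
  have h1 := Sp11.incl_ne_zero (ofCoord x)
  have hV := ((contDiffAt_coordV h1).differentiableAt (by simp)).mdifferentiableAt
  have hU := ((contDiffAt_coordU h1).differentiableAt (by simp)).mdifferentiableAt
  have hP := ((contDiffAt_coordP h1).differentiableAt (by simp)).mdifferentiableAt
  have hS : ∀ u : UnitSphere, MDifferentiableAt (𝓡 3) 𝓘(ℝ, ℍ[ℝ])
      (Subtype.val : UnitSphere → ℍ[ℝ]) u := fun u =>
    (contMDiff_coe_sphere (m := ∞) u).mdifferentiableAt (by simp)
  have hB : MDifferentiableAt 𝓘(ℝ, ℍ[ℝ]) 𝓘(ℝ, ℍ[ℝ]) (Subtype.val : UnitBall → ℍ[ℝ]) x.2.2 :=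
    contMDiff_subtype_val.contMDiffAt.mdifferentiableAt (n := ∞) (by simp)
  intro v w hvw
  have e1 := mfderiv_apply_eq_of_comp_eq hf hV (hasMFDerivAt_fst x) (hS x.1)
    (mfderiv_coe_unitSphere_injective _) (fun y => coordV_coordMatrix _ _ _) hvw
  have e2 := mfderiv_apply_eq_of_comp_eq hf hU
    ((hasMFDerivAt_fst x.2).comp x (hasMFDerivAt_snd x)) (hS x.2.1)
    (mfderiv_coe_unitSphere_injective _) (fun y => coordU_coordMatrix _ _ _) hvw
  have e3 := mfderiv_apply_eq_of_comp_eq hf hP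
    ((hasMFDerivAt_snd x.2).comp x (hasMFDerivAt_snd x)) hB
    (mfderiv_coe_unitBall_injective _) (fun y => coordP_coordMatrix _ _ _) hvw
  exact Prod.ext e1 (Prod.ext e2 e3)

theorem isEmbedding_incl_Sp11 : Topology.IsEmbedding Sp11.incl :=
  Topology.IsEmbedding.subtypeVal

/-! ### Coordinates for an arbitrary embedded structure on Sp(1,1) -/

section
variable [ChartedSpace (Model 10) Sp11] [IsManifold (𝓡 10) ∞ Sp11]

theorem contMDiff_spCoord
    (h : IsEmbeddingOfManifolds (Model 10) (Fin 2 → Fin 2 → ℍ[ℝ]) Sp11.incl) :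
    ContMDiff (𝓡 10) spModel ∞ spCoord := by
  have hi := h.contMDiff
  refine ContMDiff.prodMk ?_ (ContMDiff.prodMk ?_ ?_)
  · rw [contMDiff_unitSphere_iff]
    exact fun A => (contDiffAt_coordV (Sp11.incl_ne_zero A)).comp_contMDiffAt (hi A)
  · rw [contMDiff_unitSphere_iff]
    exact fun A => (contDiffAt_coordU (Sp11.incl_ne_zero A)).comp_contMDiffAt (hi A)
  · rw [contMDiff_unitBall_iff]
    exact fun A => (contDiffAt_coordP (Sp11.incl_ne_zero A)).comp_contMDiffAt (hi A)

/-- By the universal property of an embedded submanifold, only the smoothness of the matrix entries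
in (v, u, p) matters. Together with `contMDiff_spCoord` this makes `spCoord` a diffeomorphism,
whichever embedded structure is given. -/
theorem contMDiff_spCoord_symm
    (h : IsEmbeddingOfManifolds (Model 10) (Fin 2 → Fin 2 → ℍ[ℝ]) Sp11.incl) :
    ContMDiff spModel (𝓡 10) ∞ spCoord.symm :=
  h.contMDiff_of_comp contMDiff_coordMatrix

end

theorem finrank_mobModel : Module.finrank ℝ (Model 3 × ℍ[ℝ]) = Module.finrank ℝ (Model 7) := by
  simp [Quaternion.finrank_eq_four]

theorem finrank_spModel :
    Module.finrank ℝ (Model 3 × Model 3 × ℍ[ℝ]) = Module.finrank ℝ (Model 10) := by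
  simp [Quaternion.finrank_eq_four]

theorem finrank_ball : Module.finrank ℝ ℍ[ℝ] = Module.finrank ℝ (Model 4) := by
  simp [Quaternion.finrank_eq_four]

/-! ### The manifold structures -/

theorem exists_manifold_Sp11 : ∃ _ : ChartedSpace (Model 10) Sp11, IsManifold (𝓡 10) ∞ Sp11 ∧
    IsEmbeddingOfManifolds (Model 10) (Fin 2 → Fin 2 → ℍ[ℝ]) Sp11.incl := by
  obtain ⟨C, hC, h1, h2⟩ := exists_chartedSpace_of_homeomorph (I := spModel) spCoord
    (ContinuousLinearEquiv.ofFinrankEq finrank_spModel)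
  have e : Sp11.incl = (Sp11.incl ∘ ofCoord) ∘ spCoord := by
    funext A
    exact congrArg Sp11.incl (spCoord.symm_apply_apply A).symm
  refine ⟨C, hC, ?_, isEmbedding_incl_Sp11, fun A => ?_⟩
  · rw [e]
    exact contMDiff_coordMatrix.comp h1
  · have d1 := (h1 A).mdifferentiableAt (by simp)
    have d2 := (contMDiff_coordMatrix (spCoord A)).mdifferentiableAt (by simp)
    rw [e, mfderiv_comp A d2 d1]
    refine (mfderiv_coordMatrix_injective _).comp ?_
    exact mfderiv_injective_of_leftInverse ((h2 _).mdifferentiableAt (by simp)) d1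
      spCoord.symm_apply_apply

section
variable [ChartedSpace (Model 10) Sp11] [IsManifold (𝓡 10) ∞ Sp11]

theorem exists_manifold_RegularMobius
    (h : IsEmbeddingOfManifolds (Model 10) (Fin 2 → Fin 2 → ℍ[ℝ]) Sp11.incl) :
    ∃ _ : ChartedSpace (Model 7) RegularMobius, IsManifold (𝓡 7) ∞ RegularMobius ∧
      IsSmoothSubmersion (Model 10) (Model 7) toRegularMobius := by
  obtain ⟨C, hC, h1, h2⟩ := exists_chartedSpace_of_homeomorph (I := mobModel) mobCoord
    (ContinuousLinearEquiv.ofFinrankEq finrank_mobModel)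
  have hs : ContMDiff (𝓡 10) (𝓡 7) ∞ toRegularMobius := by
    have e : toRegularMobius = mobCoord.symm ∘ fun A => (spCoord A).2 := by
      funext A
      rw [Function.comp_apply, Homeomorph.eq_symm_apply, mobCoord_toRegularMobius]
    rw [e]
    exact h2.comp (contMDiff_snd.comp (contMDiff_spCoord h))
  refine ⟨C, hC, hs, toRegularMobius_surjective, fun A => ?_⟩
  -- Freezing the coordinate v of `A` gives a global section passing through `A`.
  have hsec : ContMDiff (𝓡 7) (𝓡 10) ∞
      fun F => spCoord.symm ((spCoord A).1, mobCoord F) :=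
    (contMDiff_spCoord_symm h).comp (contMDiff_const.prodMk h1)
  refine mfderiv_surjective_of_section ((hs A).mdifferentiableAt (by simp))
    ((hsec _).mdifferentiableAt (by simp)) (fun F => ?_) ?_
  · apply mobCoord.injective
    rw [mobCoord_toRegularMobius, Homeomorph.apply_symm_apply]
  · rw [mobCoord_toRegularMobius, Prod.mk.eta, Homeomorph.symm_apply_apply]

variable [ChartedSpace (Model 7) RegularMobius]

theorem contMDiff_mobCoord [IsManifold (𝓡 7) ∞ RegularMobius]
    (h : IsEmbeddingOfManifolds (Model 10) (Fin 2 → Fin 2 → ℍ[ℝ]) Sp11.incl)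
    (hs : IsSmoothSubmersion (Model 10) (Model 7) toRegularMobius) :
    ContMDiff (𝓡 7) mobModel ∞ mobCoord := by
  refine hs.contMDiff_of_comp ?_
  rw [show mobCoord ∘ toRegularMobius = fun A => (spCoord A).2 from
    funext mobCoord_toRegularMobius]
  exact contMDiff_snd.comp (contMDiff_spCoord h)

/-- The inverse coordinate map factors as (u, p) ↦ (1, u, p), then `spCoord.symm`, then the given
submersion. -/
theorem contMDiff_mobCoord_symm
    (h : IsEmbeddingOfManifolds (Model 10) (Fin 2 → Fin 2 → ℍ[ℝ]) Sp11.incl)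
    (hs : IsSmoothSubmersion (Model 10) (Model 7) toRegularMobius) :
    ContMDiff mobModel (𝓡 7) ∞ mobCoord.symm :=
  hs.contMDiff.comp ((contMDiff_spCoord_symm h).comp (contMDiff_const.prodMk contMDiff_id))

end

section
variable [ChartedSpace (Model 7) RegularMobius]

theorem contMDiff_inverseOrbit (h : ContMDiff (𝓡 7) mobModel ∞ mobCoord) :
    ContMDiff (𝓡 7) 𝓘(ℝ, ℍ[ℝ]) ∞ inverseOrbit := by
  rw [show inverseOrbit = fun F => (mobCoord F).2 from funext inverseOrbit_eq]
  exact contMDiff_snd.comp h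

theorem exists_manifold_Isotropy (h : ContMDiff (𝓡 7) mobModel ∞ mobCoord)
    (h' : ContMDiff mobModel (𝓡 7) ∞ mobCoord.symm) :
    ∃ _ : ChartedSpace (Model 3) Isotropy, IsManifold (𝓡 3) ∞ Isotropy ∧
      IsEmbeddingOfManifolds (Model 3) (Model 7) Isotropy.incl := by
  obtain ⟨C, hC, h1, h2⟩ := exists_chartedSpace_of_homeomorph (I := 𝓡 3) isoCoord
    (ContinuousLinearEquiv.refl ℝ (Model 3))
  have hi : ContMDiff (𝓡 3) (𝓡 7) ∞ Isotropy.incl := by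
    have e : Isotropy.incl = fun g => mobCoord.symm (isoCoord g, origin) := by
      funext g
      rw [Homeomorph.eq_symm_apply, mobCoord_incl_eq]
    rw [e]
    exact h'.comp (h1.prodMk contMDiff_const)
  -- The projection (u, p) ↦ u is a smooth retraction onto the slice p = 0.
  have hr : ContMDiff (𝓡 7) (𝓡 3) ∞ fun F => isoCoord.symm (mobCoord F).1 :=
    h2.comp (contMDiff_fst.comp h)
  refine ⟨C, hC, hi, ⟨⟨rfl⟩, Subtype.val_injective⟩, fun g => ?_⟩
  exact mfderiv_injective_of_leftInverse ((hr _).mdifferentiableAt (by simp))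
    ((hi g).mdifferentiableAt (by simp)) isoCoord.symm_apply_apply

/-- For any embedded structure `isoCoord` is a diffeomorphism onto Sp(1), and product, inverse and
action become multiplication and inversion of unit quaternions. -/
theorem isotropy_lieGroup_and_action [IsManifold (𝓡 7) ∞ RegularMobius]
    [ChartedSpace (Model 3) Isotropy] [IsManifold (𝓡 3) ∞ Isotropy] (h : ContMDiff (𝓡 7) mobModel ∞ mobCoord)
    (h' : ContMDiff mobModel (𝓡 7) ∞ mobCoord.symm)
    (hi : IsEmbeddingOfManifolds (Model 3) (Model 7) Isotropy.incl) :
    LieGroup (𝓡 3) ∞ Isotropy ∧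
      ContMDiff ((𝓡 3).prod (𝓡 7)) (𝓡 7) ∞ (fun p : Isotropy × RegularMobius => p.1 • p.2) := by
  have h1 : ContMDiff (𝓡 3) (𝓡 3) ∞ isoCoord := contMDiff_fst.comp (h.comp hi.contMDiff)
  have h2 : ContMDiff (𝓡 3) (𝓡 3) ∞ isoCoord.symm := by
    refine hi.contMDiff_of_comp ?_
    exact h'.comp (contMDiff_id.prodMk contMDiff_const)
  constructor
  · have hmul : ContMDiff ((𝓡 3).prod (𝓡 3)) (𝓡 3) ∞ fun p : Isotropy × Isotropy => p.1 * p.2 := by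
      have e : (fun p : Isotropy × Isotropy => p.1 * p.2) =
          fun p => isoCoord.symm (isoCoord p.2 * isoCoord p.1) := by
        funext p
        rw [Homeomorph.eq_symm_apply, isoCoord_mul]
      rw [e]
      exact h2.comp (contMDiff_unitSphere_mul (h1.comp contMDiff_snd) (h1.comp contMDiff_fst))
    have hinv : ContMDiff (𝓡 3) (𝓡 3) ∞ fun g : Isotropy => g⁻¹ := by
      have e : (fun g : Isotropy => g⁻¹) = fun g => isoCoord.symm (isoCoord g)⁻¹ := by
        funext g
        rw [Homeomorph.eq_symm_apply, isoCoord_inv]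
      rw [e]
      exact h2.comp (contMDiff_unitSphere_inv h1)
    exact { contMDiff_mul := hmul, contMDiff_inv := hinv }
  · have e : (fun p : Isotropy × RegularMobius => p.1 • p.2) = fun p =>
        mobCoord.symm ((mobCoord p.2).1 * isoCoord p.1, (mobCoord p.2).2) := by
      funext p
      rw [Homeomorph.eq_symm_apply, mobCoord_smul]
    rw [e]
    have h3 : ContMDiff ((𝓡 3).prod (𝓡 7)) mobModel ∞
        fun p : Isotropy × RegularMobius => mobCoord p.2 := h.comp contMDiff_snd
    exact h'.comp (ContMDiff.prodMk
      (contMDiff_unitSphere_mul (contMDiff_fst.comp h3) (h1.comp contMDiff_fst))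
      (contMDiff_snd.comp h3))

theorem exists_manifold_OrbitSpace (h : ContMDiff (𝓡 7) mobModel ∞ mobCoord)
    (h' : ContMDiff mobModel (𝓡 7) ∞ mobCoord.symm) :
    ∃ _ : ChartedSpace (Model 4) OrbitSpace, IsManifold (𝓡 4) ∞ OrbitSpace ∧
      IsSmoothSubmersion (Model 7) (Model 4) orbitProj := by
  obtain ⟨C, hC, h1, h2⟩ := exists_chartedSpace_of_homeomorph (I := 𝓘(ℝ, ℍ[ℝ])) orbCoord
    (ContinuousLinearEquiv.ofFinrankEq finrank_ball)
  have hs : ContMDiff (𝓡 7) (𝓡 4) ∞ orbitProj := by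
    have e : orbitProj = orbCoord.symm ∘ inverseOrbit := by
      funext F
      rw [Function.comp_apply, Homeomorph.eq_symm_apply, orbCoord_orbitProj]
    rw [e]
    exact h2.comp (contMDiff_inverseOrbit h)
  refine ⟨C, hC, hs, Quotient.mk_surjective, fun F => ?_⟩
  -- Freezing the coordinate u of `F` gives a global section passing through `F`.
  have hsec : ContMDiff (𝓡 4) (𝓡 7) ∞ fun O => mobCoord.symm ((mobCoord F).1, orbCoord O) :=
    h'.comp (contMDiff_const.prodMk h1)
  refine mfderiv_surjective_of_section ((hs F).mdifferentiableAt (by simp))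
    ((hsec _).mdifferentiableAt (by simp)) (fun O => ?_) ?_
  · apply orbCoord.injective
    rw [orbCoord_orbitProj, inverseOrbit_eq, Homeomorph.apply_symm_apply]
  · rw [orbCoord_orbitProj, inverseOrbit_eq, Prod.mk.eta, Homeomorph.symm_apply_apply]

/-- The diffeomorphism of the orbit space onto the unit ball. -/
def orbDiffeomorph [IsManifold (𝓡 7) ∞ RegularMobius]
    [ChartedSpace (Model 4) OrbitSpace] [IsManifold (𝓡 4) ∞ OrbitSpace]
    (h : ContMDiff (𝓡 7) mobModel ∞ mobCoord) (h' : ContMDiff mobModel (𝓡 7) ∞ mobCoord.symm)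
    (hs : IsSmoothSubmersion (Model 7) (Model 4) orbitProj) :
    Diffeomorph (𝓡 4) 𝓘(ℝ, ℍ[ℝ]) OrbitSpace UnitBall ∞ where
  toEquiv := orbCoord.toEquiv
  -- Precomposed with the submersion, the map is the inverse orbit map; its inverse is p ↦ (1, p)
  -- followed by `mobCoord.symm` and the projection to orbits.
  contMDiff_toFun := hs.contMDiff_of_comp (contMDiff_inverseOrbit h)
  contMDiff_invFun := hs.contMDiff.comp (h'.comp (contMDiff_const.prodMk contMDiff_id))

end

end SliceMobius

end

open SliceMobius

theorem mainTheorem4 :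
    -- the left action of the isotropy on `𝓜(𝔹)` by composition is free and proper
    (∀ (g : Isotropy) (F : RegularMobius), g • F = F → g = 1) ∧
    (∀ K : Set RegularMobius, IsCompact K →
      IsCompact {g : Isotropy | (((fun F => g • F) '' K) ∩ K).Nonempty}) ∧
    T2Space RegularMobius ∧ SecondCountableTopology RegularMobius ∧
    -- `Sp(1,1)` is an embedded submanifold of `M₂(ℍ)`, of dimension 10
    (∃ _ : ChartedSpace (Model 10) Sp11, IsManifold (𝓡 10) ∞ Sp11 ∧
      IsEmbeddingOfManifolds (Model 10) (Fin 2 → Fin 2 → ℍ[ℝ]) Sp11.incl) ∧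
    ∀ [ChartedSpace (Model 10) Sp11] [IsManifold (𝓡 10) ∞ Sp11],
      IsEmbeddingOfManifolds (Model 10) (Fin 2 → Fin 2 → ℍ[ℝ]) Sp11.incl →
      -- the manifold structure of `𝓜(𝔹)` as a quotient of `Sp(1,1)`, of dimension 7
      (∃ _ : ChartedSpace (Model 7) RegularMobius, IsManifold (𝓡 7) ∞ RegularMobius ∧
        IsSmoothSubmersion (Model 10) (Model 7) toRegularMobius) ∧
      ∀ [ChartedSpace (Model 7) RegularMobius] [IsManifold (𝓡 7) ∞ RegularMobius],
        IsSmoothSubmersion (Model 10) (Model 7) toRegularMobius →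
        -- the inverse orbit map is smooth
        ContMDiff (𝓡 7) 𝓘(ℝ, ℍ[ℝ]) ∞ inverseOrbit ∧
        -- the isotropy is an embedded submanifold of `𝓜(𝔹)`, a Lie group, and acts smoothly
        (∃ _ : ChartedSpace (Model 3) Isotropy, IsManifold (𝓡 3) ∞ Isotropy ∧
          IsEmbeddingOfManifolds (Model 3) (Model 7) Isotropy.incl) ∧
        (∀ [ChartedSpace (Model 3) Isotropy] [IsManifold (𝓡 3) ∞ Isotropy],
          IsEmbeddingOfManifolds (Model 3) (Model 7) Isotropy.incl →
          LieGroup (𝓡 3) ∞ Isotropy ∧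
          ContMDiff ((𝓡 3).prod (𝓡 7)) (𝓡 7) ∞
            (fun p : Isotropy × RegularMobius => p.1 • p.2)) ∧
        -- the manifold structure of the orbit space, of dimension 4
        (∃ _ : ChartedSpace (Model 4) OrbitSpace, IsManifold (𝓡 4) ∞ OrbitSpace ∧
          IsSmoothSubmersion (Model 7) (Model 4) orbitProj) ∧
        -- the inverse orbit map induces a diffeomorphism of the orbit space onto the ball
        ∀ [ChartedSpace (Model 4) OrbitSpace] [IsManifold (𝓡 4) ∞ OrbitSpace],
          IsSmoothSubmersion (Model 7) (Model 4) orbitProj →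
          ∃ Φ : Diffeomorph (𝓡 4) 𝓘(ℝ, ℍ[ℝ]) OrbitSpace UnitBall ∞,
            ∀ F : RegularMobius, Φ (orbitProj F) = inverseOrbit F := by
  refine ⟨smul_free, smul_proper, inferInstance, inferInstance, exists_manifold_Sp11, ?_⟩
  intro _ _ hSp
  refine ⟨exists_manifold_RegularMobius hSp, ?_⟩
  intro _ _ hM
  -- From here the given structures on Sp(1,1) and 𝓜(𝔹) enter only through the fact that `mobCoord`
  -- is a diffeomorphism.
  have h := contMDiff_mobCoord hSp hM
  have h' := contMDiff_mobCoord_symm hSp hM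
  refine ⟨contMDiff_inverseOrbit h, exists_manifold_Isotropy h h', ?_,
    exists_manifold_OrbitSpace h h', ?_⟩
  · intro _ _ hi
    exact isotropy_lieGroup_and_action h h' hi
  · intro _ _ hs
    exact ⟨orbDiffeomorph h h' hs, fun _ => rfl⟩
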